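/- Let $\Omega\subset\mathbb R^2$ be a bounded connected open (Lipschitz) polygon (near each boundary point it coincides with an open sector of angle in $(0,2\pi)$). Let $\mathcal G_1=\{G^1_i\}_{i\le I}$ and $\mathcal G_2=\{G^2_j\}_{j\le J}$ be finite families of connected open polygons (in the same sense) contained in $\Omega$, all $G^1_i, G^2_j$ pairwise disjoint, such that $|\Omega\setminus\bigcup_{G\in\mathcal G_1\cup\mathcal G_2} G|=0$, $\overline\Omega=\bigcup_{G}\overline G$, the boundaries of two different members of the same family meet in a set of length $0$, and, with $\Omega_1=\bigcup_i G^1_i$, $\Omega_2=\bigcup_j G^2_j$, the closures $\overline{\Omega_1}$ and $\overline{\Omega_2}$ are connected. Let $\Gamma=\bigcup_{G}\partial G\setminus\partial\Omega$, and let $\widehat n$ be the unit normal on $\Gamma$ pointing out of $\Omega_1$. Let $a:\Omega\to(0,\infty)$ with $a,\,1/a\in L^\infty(\Omega)$, and $\beta:\Gamma\to[0,\infty)$ with $\beta\in L^\infty(\Gamma)$ and $\|\beta\|_{L^1(\Gamma)}>0$. Let $\mathcal T$ be a (conforming) triangulation of $\Omega$ by open triangles $K$, each satisfying $K\cap\Omega_1=\emptyset$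 or $K\cap\Omega_2=\emptyset$. Put $$\begin{aligned} RT_0(\Omega_1)&=\{v\in H_{\rm div}(\Omega_1): v|_K\in P_0(K)^2+xP_0(K)\ \ \forall K\in\mathcal T,\,K\subseteq\Omega_1\},\\ Q(\Omega_2)&=\{q\in H^1(\Omega_2): q=\xi|_{\Omega_2}\text{ for some }\xi\in H^1(\Omega),\ q|_K\in P_1(K)\ \ \forall K\in\mathcal T,\,K\subseteq\Omega_2\},\\ \nabla Q(\Omega_2)&=\{w\in L^2(\Omega_2)^2: w|_K\in P_0(K)^2\ \ \forall K\in\mathcal T,\,K\subseteq\Omega_2,\ w=\nabla q\text{ for some }q\in Q(\Omega_2)\},\\ Q(\Omega_1)&=\{r\in L^2(\Omega_1): r|_K\in P_0(K)\ \ \forall K\in\mathcal T,\,K\subseteq\Omega_1\}, \end{aligned}$$ where $P_\ell(K)$ denotes the polynomials of degree at most $\ell$ on $K$. Let $X_h=RT_0(\Omega_1)\times Q(\Omega_2)$ with the norm $\|[v_1,q_2]\|_X^2=\|v_1\|_{L^2(\Omega_1)}^2+\|\nabla\cdot v_1\|_{L^2(\Omega_1)}^2+\|q_2\|_{L^2(\Omega_2)}^2+\|\nabla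 q_2\|_{L^2(\Omega_2)}^2$, and let $Y_h=\nabla Q(\Omega_2)\times Q(\Omega_1)$ with the $L^2$ norm. Define, with traces on $\Gamma$ taken from $\Omega_1$ for velocities and from $\Omega_2$ for pressures, $$A_h[v_1,q_2]([w_1,r_2])=\int_{\Omega_1}a\,v_1\cdot w_1+\int_\Gamma\beta q_2r_2\,dS-\int_\Gamma(v_1\cdot\widehat n)\,r_2\,dS+\int_\Gamma q_2\,(w_1\cdot\widehat n)\,dS$$ for $[v_1,q_2],[w_1,r_2]\in X_h$, and $$B_h[v_1,q_2]([w_2,r_1])=\int_{\Omega_1}(\nabla\cdot v_1)\,r_1+\int_{\Omega_2}\nabla q_2\cdot w_2$$ for $[v_1,q_2]\in X_h$, $[w_2,r_1]\in Y_h$. Then: 1. $A_h$ is a continuous linear operator from $X_h$ to its dual $X_h'$. 2. If $[v_1,q_2]\in\ker B_h$, i.e. $B_h[v_1,q_2]$ vanishes on $Y_h$, then $\nabla\cdot v_1=0$ and $q_2$ is (almost everywhere equal to) one constant on all of $\Omega_2$. 3. With $C=\min\{\|1/a\|_{L^\infty(\Omega)}^{-1},\ \|\beta\|_{L^1(\Gamma)}/|\Omega_2|\}$,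 which is positive and does not depend on $\mathcal T$, $$A_h[v_1,q_2]([v_1,q_2])\ \ge\ C\,\|[v_1,q_2]\|_X^2\qquad\text{for all }[v_1,q_2]\in\ker B_h .$$ -/

import Mathlib

noncomputable section

namespace PrimalDual

open MeasureTheory Metric Set Filter Topology
open scoped ENNReal ContDiff

/-- The Euclidean plane. -/
abbrev Plane : Type := EuclideanSpace ℝ (Fin 2)

/-! ### Geometry -/

/-- The open circular sector with apex `x`, radius `r`, whose directions have angles in the open
interval `(α, α + γ)`. -/
def sector (x : Plane) (r α γ : ℝ) : Set Plane :=
  {y | ∃ ρ θ : ℝ, 0 < ρ ∧ ρ < r ∧ α < θ ∧ θ < α + γ ∧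
    y = x + ρ • (!₂[Real.cos θ, Real.sin θ] : Plane)}

/-- Connected open (Lipschitz) polygons: a bounded, connected, open, nonempty set that coincides,
near each boundary point, with a sector of opening angle in `(0, 2π)` (the angle is `π` at the
points inside an edge). By compactness of the boundary, these are exactly the bounded domains
whose boundary is a finite disjoint union of simple closed polygonal lines. -/
structure IsPolygon (U : Set Plane) : Prop where
  isOpen : IsOpen U
  isConnected : IsConnected U
  isBounded : Bornology.IsBounded U
  locally_sector : ∀ x ∈ frontier U, ∃ r α γ : ℝ, 0 < r ∧ 0 < γ ∧ γ < 2 * Real.pi ∧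
    U ∩ ball x r = sector x r α γ

/-- `G₁, G₂` are the two colour classes of a bipartite map of `W`. The size of the intersection of
two boundaries is its length, i.e. its one-dimensional Hausdorff measure. -/
structure IsBipartiteMap {I J : ℕ} (W : Set Plane) (G₁ : Fin I → Set Plane)
    (G₂ : Fin J → Set Plane) : Prop where
  isOpen : ∀ n, IsOpen (Sum.elim G₁ G₂ n)
  isConnected : ∀ n, IsConnected (Sum.elim G₁ G₂ n)
  subset : ∀ n, Sum.elim G₁ G₂ n ⊆ W
  disjoint : ∀ n k, n ≠ k → Sum.elim G₁ G₂ n ∩ Sum.elim G₁ G₂ k = ∅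
  null_diff : volume (W \ ⋃ n, Sum.elim G₁ G₂ n) = 0
  closure_eq : closure W = ⋃ n, closure (Sum.elim G₁ G₂ n)
  frontier₁ : ∀ i k, i ≠ k → μH[1] (frontier (G₁ i) ∩ frontier (G₁ k)) = 0
  frontier₂ : ∀ j l, j ≠ l → μH[1] (frontier (G₂ j) ∩ frontier (G₂ l)) = 0

/-- The region covered by one colour class. -/
def region {I : ℕ} (G : Fin I → Set Plane) : Set Plane := ⋃ i, G i

/-- The geometric hypothesis: a polygonal domain with a bipartite map made of polygons, such that
the closure of each of the two regions is connected. -/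
structure GeometricHypothesis {I J : ℕ} (Ω : Set Plane) (G₁ : Fin I → Set Plane)
    (G₂ : Fin J → Set Plane) : Prop where
  domain : IsPolygon Ω
  map : IsBipartiteMap Ω G₁ G₂
  polygon₁ : ∀ i, IsPolygon (G₁ i)
  polygon₂ : ∀ j, IsPolygon (G₂ j)
  connected₁ : IsConnected (closure (region G₁))
  connected₂ : IsConnected (closure (region G₂))

/-- The interface: the union of the boundaries of all elements of the map, minus `∂Ω`. -/
def interface {I J : ℕ} (Ω : Set Plane) (G₁ : Fin I → Set Plane) (G₂ : Fin J → Set Plane) :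
    Set Plane :=
  (⋃ n, frontier (Sum.elim G₁ G₂ n)) \ frontier Ω

/-- The length measure `dS` on a subset of the plane. -/
def surfaceMeasure (Γ : Set Plane) : Measure Plane := (μH[1] : Measure Plane).restrict Γ

/-- `ν` is the outer unit normal of `U` at `x`: near `x`, `U` is an open half-disc lying
opposite to `ν`. -/
def IsOuterNormal (U : Set Plane) (x ν : Plane) : Prop :=
  ‖ν‖ = 1 ∧ ∃ r > 0, U ∩ ball x r = {y ∈ ball x r | inner ℝ (y - x) ν < 0}

open Classical in
/-- The outer unit normal of `U` at `x` (zero at the finitely many points, such as vertices, of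
the boundary of a polygonal set where it is not defined). -/
def outerNormal (U : Set Plane) (x : Plane) : Plane :=
  if h : ∃ ν, IsOuterNormal U x ν then h.choose else 0

/-- The open triangle with the given set of vertices. -/
def triangle (t : Finset Plane) : Set Plane := interior (convexHull ℝ (t : Set Plane))

/-- A (conforming) triangulation of `Ω`; a triangle is given by the set of its three vertices. -/
structure IsTriangulation (Ω : Set Plane) (T : Finset (Finset Plane)) : Prop where
  card : ∀ t ∈ T, t.card = 3
  affineIndependent : ∀ t ∈ T, AffineIndependent ℝ ((↑) : t → Plane)
  conforming : ∀ s ∈ T, ∀ t ∈ T, convexHull ℝ (s : Set Plane) ∩ convexHull ℝ (t : Set Plane) =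
    convexHull ℝ ((s : Set Plane) ∩ (t : Set Plane))
  covers : ⋃ t ∈ T, convexHull ℝ (t : Set Plane) = closure Ω

/-- The triangulation is consistent with the two regions: no triangle meets both. -/
def IsConsistent (T : Finset (Finset Plane)) (Ω₁ Ω₂ : Set Plane) : Prop :=
  ∀ t ∈ T, triangle t ∩ Ω₁ = ∅ ∨ triangle t ∩ Ω₂ = ∅

/-! ### Function spaces -/

/-- `L²(U)`. -/
abbrev L2 (U : Set Plane) : Type := Lp ℝ 2 ((volume : Measure Plane).restrict U)

/-- `L²(U)²`. -/
abbrev L2v (U : Set Plane) : Type := Lp Plane 2 ((volume : Measure Plane).restrict U)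

/-- Test functions on `U`. -/
def IsTest (U : Set Plane) (φ : Plane → ℝ) : Prop :=
  ContDiff ℝ ∞ φ ∧ HasCompactSupport φ ∧ tsupport φ ⊆ U

/-- `d` is the weak divergence of `v` on `U`. -/
def IsWeakDiv (U : Set Plane) (v : Plane → Plane) (d : Plane → ℝ) : Prop :=
  ∀ φ, IsTest U φ → ∫ x in U, inner ℝ (v x) (gradient φ x) = -∫ x in U, d x * φ x

/-- `g` is the weak gradient of `q` on `U`. -/
def IsWeakGrad (U : Set Plane) (q : Plane → ℝ) (g : Plane → Plane) : Prop :=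
  ∀ φ, IsTest U φ → ∫ x in U, q x • gradient φ x = -∫ x in U, φ x • g x

theorem IsTest.memLp {U : Set Plane} {φ : Plane → ℝ} (h : IsTest U φ) (p : ℝ≥0∞) (V : Set Plane) :
    MemLp φ p (volume.restrict V) :=
  (h.1.continuous.memLp_of_hasCompactSupport h.2.1).restrict V

theorem IsTest.memLp_gradient {U : Set Plane} {φ : Plane → ℝ} (h : IsTest U φ) (p : ℝ≥0∞)
    (V : Set Plane) : MemLp (gradient φ) p (volume.restrict V) := by
  have h1 : Continuous (gradient φ) :=
    (InnerProductSpace.toDual ℝ Plane).symm.continuous.comp (h.1.continuous_fderiv (by simp))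
  have h2 : HasCompactSupport (gradient φ) :=
    (h.2.1.fderiv ℝ).comp_left (g := (InnerProductSpace.toDual ℝ Plane).symm) (map_zero _)
  exact (h1.memLp_of_hasCompactSupport h2).restrict V

/-- `H_div(U)`: pairs `[v, d]` of an `L²` field and its `L²` weak divergence, with the norm
`(‖v‖² + ‖d‖²)^(1/2)`. -/
def Hdiv (U : Set Plane) : Submodule ℝ (WithLp 2 (L2v U × L2 U)) where
  carrier := {z | IsWeakDiv U z.fst z.snd}
  zero_mem' := by
    intro φ _
    have h1 : ∫ x in U, inner ℝ ((0 : L2v U) x) (gradient φ x) = ∫ _x in U, (0 : ℝ) := by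
      apply integral_congr_ae
      filter_upwards [Lp.coeFn_zero Plane 2 (volume.restrict U)] with x hx
      rw [hx]; simp
    have h2 : ∫ x in U, (0 : L2 U) x * φ x = ∫ _x in U, (0 : ℝ) := by
      apply integral_congr_ae
      filter_upwards [Lp.coeFn_zero ℝ 2 (volume.restrict U)] with x hx
      rw [hx]; simp
    exact h1.trans ((integral_zero _ _).trans
      (neg_eq_zero.2 (h2.trans (integral_zero _ _))).symm)
  add_mem' := by
    intro z w hz hw φ hφ
    have h1 : ∫ x in U, inner ℝ ((z.fst + w.fst) x) (gradient φ x) =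
        ∫ x in U, (inner ℝ (z.fst x) (gradient φ x) + inner ℝ (w.fst x) (gradient φ x)) := by
      apply integral_congr_ae
      filter_upwards [Lp.coeFn_add z.fst w.fst] with x hx
      rw [hx, Pi.add_apply, inner_add_left]
    have h2 : ∫ x in U, (z.snd + w.snd) x * φ x =
        ∫ x in U, (z.snd x * φ x + w.snd x * φ x) := by
      apply integral_congr_ae
      filter_upwards [Lp.coeFn_add z.snd w.snd] with x hx
      rw [hx, Pi.add_apply, add_mul]
    have i (f : L2v U) : Integrable (fun x => inner ℝ (f x) (gradient φ x)) (volume.restrict U) :=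
      memLp_one_iff_integrable.1 ((Lp.memLp f).of_bilin (r := 1) (fun u v : Plane => (inner ℝ u v : ℝ)) 1
        (hφ.memLp_gradient 2 U) ((Lp.aestronglyMeasurable f).inner (𝕜 := ℝ) (hφ.memLp_gradient 2 U).1)
        (ae_of_all _ fun x => by
          simpa only [one_mul] using nnnorm_inner_le_nnnorm (𝕜 := ℝ) (f x) (gradient φ x)))
    have k (f : L2 U) : Integrable (fun x => f x * φ x) (volume.restrict U) :=
      (Lp.memLp f).integrable_mul (hφ.memLp 2 U)
    rw [WithLp.add_fst, WithLp.add_snd, h1, h2,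
      integral_add (i _) (i _),
      integral_add (k _) (k _), hz φ hφ, hw φ hφ]
    ring
  smul_mem' := by
    intro c z hz φ hφ
    have h1 : ∫ x in U, inner ℝ ((c • z.fst) x) (gradient φ x) =
        ∫ x in U, c * inner ℝ (z.fst x) (gradient φ x) := by
      apply integral_congr_ae
      filter_upwards [Lp.coeFn_smul c z.fst] with x hx
      rw [hx, Pi.smul_apply, real_inner_smul_left]
    have h2 : ∫ x in U, (c • z.snd) x * φ x = ∫ x in U, c * (z.snd x * φ x) := by
      apply integral_congr_ae
      filter_upwards [Lp.coeFn_smul c z.snd] with x hx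
      rw [hx, Pi.smul_apply, smul_eq_mul, mul_assoc]
    rw [WithLp.smul_fst, WithLp.smul_snd, h1, h2, integral_const_mul, integral_const_mul, hz φ hφ]
    ring

/-- `H¹(U)`: pairs `[q, g]` of an `L²` function and its `L²` weak gradient, with the norm
`(‖q‖² + ‖g‖²)^(1/2)`. -/
def H1 (U : Set Plane) : Submodule ℝ (WithLp 2 (L2 U × L2v U)) where
  carrier := {z | IsWeakGrad U z.fst z.snd}
  zero_mem' := by
    intro φ _
    have h1 : ∫ x in U, (0 : L2 U) x • gradient φ x = ∫ _x in U, (0 : Plane) := by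
      apply integral_congr_ae
      filter_upwards [Lp.coeFn_zero ℝ 2 (volume.restrict U)] with x hx
      rw [hx]; simp
    have h2 : ∫ x in U, φ x • (0 : L2v U) x = ∫ _x in U, (0 : Plane) := by
      apply integral_congr_ae
      filter_upwards [Lp.coeFn_zero Plane 2 (volume.restrict U)] with x hx
      rw [hx]; simp
    exact h1.trans ((integral_zero _ _).trans
      (neg_eq_zero.2 (h2.trans (integral_zero _ _))).symm)
  add_mem' := by
    intro z w hz hw φ hφ
    have h1 : ∫ x in U, (z.fst + w.fst) x • gradient φ x =
        ∫ x in U, (z.fst x • gradient φ x + w.fst x • gradient φ x) := by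
      apply integral_congr_ae
      filter_upwards [Lp.coeFn_add z.fst w.fst] with x hx
      rw [hx, Pi.add_apply, add_smul]
    have h2 : ∫ x in U, φ x • (z.snd + w.snd) x =
        ∫ x in U, (φ x • z.snd x + φ x • w.snd x) := by
      apply integral_congr_ae
      filter_upwards [Lp.coeFn_add z.snd w.snd] with x hx
      rw [hx, Pi.add_apply, smul_add]
    have i (f : L2 U) : Integrable (fun x => f x • gradient φ x) (volume.restrict U) :=
      memLp_one_iff_integrable.1 ((hφ.memLp_gradient 2 U).smul (Lp.memLp f))
    have k (f : L2v U) : Integrable (fun x => φ x • f x) (volume.restrict U) :=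
      memLp_one_iff_integrable.1 ((Lp.memLp f).smul (hφ.memLp 2 U))
    rw [WithLp.add_fst, WithLp.add_snd, h1, h2, integral_add (i _) (i _),
      integral_add (k _) (k _), hz φ hφ, hw φ hφ, neg_add]
  smul_mem' := by
    intro c z hz φ hφ
    have h1 : ∫ x in U, (c • z.fst) x • gradient φ x =
        ∫ x in U, c • (z.fst x • gradient φ x) := by
      apply integral_congr_ae
      filter_upwards [Lp.coeFn_smul c z.fst] with x hx
      rw [hx, Pi.smul_apply, smul_eq_mul, mul_smul]
    have h2 : ∫ x in U, φ x • (c • z.snd) x = ∫ x in U, c • (φ x • z.snd x) := by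
      apply integral_congr_ae
      filter_upwards [Lp.coeFn_smul c z.snd] with x hx
      rw [hx, Pi.smul_apply, smul_comm]
    rw [WithLp.smul_fst, WithLp.smul_snd, h1, h2, integral_smul, integral_smul, hz φ hφ, smul_neg]

/-! ### Polynomial spaces on a set `K` (up to null sets) -/

/-- `f|_K ∈ P₀(K)`. -/
def IsConstOn {F : Type*} (K : Set Plane) (f : Plane → F) : Prop :=
  ∃ c : F, ∀ᵐ x ∂(volume.restrict K), f x = c

/-- `f|_K ∈ P₁(K)`. -/
def IsAffineOn (K : Set Plane) (f : Plane → ℝ) : Prop :=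
  ∃ (c : ℝ) (b : Plane), ∀ᵐ x ∂(volume.restrict K), f x = c + inner ℝ b x

/-- `v|_K ∈ RT₀(K)`, the lowest order Raviart-Thomas element `P₀(K)² + x P₀(K)`. -/
def IsRTOn (K : Set Plane) (v : Plane → Plane) : Prop :=
  ∃ (c : Plane) (s : ℝ), ∀ᵐ x ∂(volume.restrict K), v x = c + s • x

theorem IsConstOn.zero {F : Type*} [NormedAddCommGroup F] {K U : Set Plane} (h : K ⊆ U) :
    IsConstOn K (0 : Lp F 2 ((volume : Measure Plane).restrict U)) :=
  ⟨0, ae_restrict_of_ae_restrict_of_subset h (Lp.coeFn_zero _ _ _)⟩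

theorem IsConstOn.add {F : Type*} [NormedAddCommGroup F] {K U : Set Plane} (h : K ⊆ U)
    {f g : Lp F 2 ((volume : Measure Plane).restrict U)} (hf : IsConstOn K f)
    (hg : IsConstOn K g) : IsConstOn K (f + g) := by
  obtain ⟨c, hc⟩ := hf
  obtain ⟨d, hd⟩ := hg
  refine ⟨c + d, ?_⟩
  filter_upwards [hc, hd, ae_restrict_of_ae_restrict_of_subset h (Lp.coeFn_add f g)]
    with x h1 h2 h3
  rw [h3, Pi.add_apply, h1, h2]

theorem IsConstOn.smul {F : Type*} [NormedAddCommGroup F] [NormedSpace ℝ F] {K U : Set Plane}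
    (h : K ⊆ U) (t : ℝ) {f : Lp F 2 ((volume : Measure Plane).restrict U)}
    (hf : IsConstOn K f) : IsConstOn K (t • f) := by
  obtain ⟨c, hc⟩ := hf
  refine ⟨t • c, ?_⟩
  filter_upwards [hc, ae_restrict_of_ae_restrict_of_subset h (Lp.coeFn_smul t f)] with x h1 h2
  rw [h2, Pi.smul_apply, h1]

/-! ### Discrete spaces -/

/-- `RT₀(U, T)`. -/
def RT0 (U : Set Plane) (T : Finset (Finset Plane)) : Submodule ℝ (Hdiv U) where
  carrier := {z | ∀ t ∈ T, triangle t ⊆ U → IsRTOn (triangle t) (z : WithLp 2 (L2v U × L2 U)).fst}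
  zero_mem' := by
    intro t _ h
    refine ⟨0, 0, ?_⟩
    filter_upwards [ae_restrict_of_ae_restrict_of_subset h (Lp.coeFn_zero Plane 2 _)] with x hx
    simpa using hx
  add_mem' := by
    intro z w hz hw t ht h
    obtain ⟨c, s, hc⟩ := hz t ht h
    obtain ⟨d, s', hd⟩ := hw t ht h
    refine ⟨c + d, s + s', ?_⟩
    filter_upwards [hc, hd, ae_restrict_of_ae_restrict_of_subset h (Lp.coeFn_add z.1.fst w.1.fst)]
      with x h1 h2 h3
    rw [Submodule.coe_add, WithLp.add_fst, h3, Pi.add_apply, h1, h2, add_smul]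
    abel
  smul_mem' := by
    intro r z hz t ht h
    obtain ⟨c, s, hc⟩ := hz t ht h
    refine ⟨r • c, r * s, ?_⟩
    filter_upwards [hc, ae_restrict_of_ae_restrict_of_subset h (Lp.coeFn_smul r z.1.fst)]
      with x h1 h3
    rw [Submodule.coe_smul, WithLp.smul_fst, h3, Pi.smul_apply, h1, smul_add, mul_smul]

/-- `Q(Ω₂, T)`: the elements of `H¹(Ω₂)` that are restrictions of elements of `H¹(Ω)` and are
polynomials of degree at most one on each triangle contained in `Ω₂`. (`Ω ∩ Ω₂ = Ω₂` in the
situation of interest, where `Ω₂ ⊆ Ω`.) -/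
def QPressure (Ω Ω₂ : Set Plane) (T : Finset (Finset Plane)) : Submodule ℝ (H1 Ω₂) where
  carrier := {z |
    (∃ ξ : H1 Ω, ∀ᵐ x ∂((volume : Measure Plane).restrict (Ω ∩ Ω₂)),
      (z : WithLp 2 (L2 Ω₂ × L2v Ω₂)).fst x = (ξ : WithLp 2 (L2 Ω × L2v Ω)).fst x) ∧
    ∀ t ∈ T, triangle t ⊆ Ω₂ → IsAffineOn (triangle t) (z : WithLp 2 (L2 Ω₂ × L2v Ω₂)).fst}
  zero_mem' := by
    refine ⟨⟨0, ?_⟩, ?_⟩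
    · filter_upwards [ae_restrict_of_ae_restrict_of_subset inter_subset_left (Lp.coeFn_zero ℝ 2 _),
        ae_restrict_of_ae_restrict_of_subset inter_subset_right (Lp.coeFn_zero ℝ 2 _)]
        with x h1 h2
      exact h2.trans h1.symm
    · intro t _ h
      refine ⟨0, 0, ?_⟩
      filter_upwards [ae_restrict_of_ae_restrict_of_subset h (Lp.coeFn_zero ℝ 2 _)] with x hx
      simpa using hx
  add_mem' := by
    rintro z w ⟨⟨ξ, hξ⟩, hz⟩ ⟨⟨η, hη⟩, hw⟩
    refine ⟨⟨ξ + η, ?_⟩, ?_⟩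
    · filter_upwards [hξ, hη, ae_restrict_of_ae_restrict_of_subset inter_subset_left
        (Lp.coeFn_add ξ.1.fst η.1.fst), ae_restrict_of_ae_restrict_of_subset inter_subset_right
        (Lp.coeFn_add z.1.fst w.1.fst)] with x h1 h2 h3 h4
      rw [Submodule.coe_add, Submodule.coe_add, WithLp.add_fst, WithLp.add_fst, h3, h4,
        Pi.add_apply, Pi.add_apply, h1, h2]
    · intro t ht h
      obtain ⟨c, b, hc⟩ := hz t ht h
      obtain ⟨d, b', hd⟩ := hw t ht h
      refine ⟨c + d, b + b', ?_⟩
      filter_upwards [hc, hd, ae_restrict_of_ae_restrict_of_subset h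
        (Lp.coeFn_add z.1.fst w.1.fst)] with x h1 h2 h3
      rw [Submodule.coe_add, WithLp.add_fst, h3, Pi.add_apply, h1, h2, inner_add_left]
      ring
  smul_mem' := by
    rintro r z ⟨⟨ξ, hξ⟩, hz⟩
    refine ⟨⟨r • ξ, ?_⟩, ?_⟩
    · filter_upwards [hξ, ae_restrict_of_ae_restrict_of_subset inter_subset_left
        (Lp.coeFn_smul r ξ.1.fst), ae_restrict_of_ae_restrict_of_subset inter_subset_right
        (Lp.coeFn_smul r z.1.fst)] with x h1 h3 h4
      rw [Submodule.coe_smul, Submodule.coe_smul, WithLp.smul_fst, WithLp.smul_fst, h3, h4,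
        Pi.smul_apply, Pi.smul_apply, h1]
    · intro t ht h
      obtain ⟨c, b, hc⟩ := hz t ht h
      refine ⟨r * c, r • b, ?_⟩
      filter_upwards [hc, ae_restrict_of_ae_restrict_of_subset h (Lp.coeFn_smul r z.1.fst)]
        with x h1 h3
      rw [Submodule.coe_smul, WithLp.smul_fst, h3, Pi.smul_apply, h1, inner_smul_left, smul_eq_mul]
      simp [mul_add]

/-- `∇Q(Ω₂, T)`: piecewise constant fields that are gradients of elements of `Q(Ω₂, T)`. -/
def GradQ (Ω Ω₂ : Set Plane) (T : Finset (Finset Plane)) : Submodule ℝ (L2v Ω₂) where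
  carrier := {w | (∀ t ∈ T, triangle t ⊆ Ω₂ → IsConstOn (triangle t) w) ∧
    ∃ z ∈ QPressure Ω Ω₂ T, (z : WithLp 2 (L2 Ω₂ × L2v Ω₂)).snd = w}
  zero_mem' := ⟨fun _ _ h => IsConstOn.zero h, 0, zero_mem _, rfl⟩
  add_mem' := by
    rintro w w' ⟨h, z, hz, rfl⟩ ⟨h', z', hz', rfl⟩
    exact ⟨fun t ht hs => (h t ht hs).add hs (h' t ht hs), z + z', add_mem hz hz', rfl⟩
  smul_mem' := by
    rintro r w ⟨h, z, hz, rfl⟩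
    exact ⟨fun t ht hs => (h t ht hs).smul hs r, r • z, Submodule.smul_mem _ r hz, rfl⟩

/-- `Q(Ω₁, T)`: square integrable functions, constant on each triangle contained in `Ω₁`. -/
def QConst (Ω₁ : Set Plane) (T : Finset (Finset Plane)) : Submodule ℝ (L2 Ω₁) where
  carrier := {r | ∀ t ∈ T, triangle t ⊆ Ω₁ → IsConstOn (triangle t) r}
  zero_mem' := fun _ _ h => IsConstOn.zero h
  add_mem' := fun h h' t ht hs => (h t ht hs).add hs (h' t ht hs)
  smul_mem' := fun r _ h t ht hs => (h t ht hs).smul hs r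

/-- `H_div(Ω₁) × H¹(Ω₂)` with the norm `‖[v₁, q₂]‖_X = (‖v₁‖²_{H_div} + ‖q₂‖²_{H¹})^(1/2)`. -/
abbrev XSpace (Ω₁ Ω₂ : Set Plane) : Type := WithLp 2 (Hdiv Ω₁ × H1 Ω₂)

/-- `L²(Ω₂)² × L²(Ω₁)` with the norm `‖[w₂, r₁]‖_Y = (‖w₂‖²_{L²} + ‖r₁‖²_{L²})^(1/2)`. -/
abbrev YSpace (Ω₁ Ω₂ : Set Plane) : Type := WithLp 2 (L2v Ω₂ × L2 Ω₁)

/-- `X_h = RT₀(Ω₁) × Q(Ω₂)`. -/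
def Xh (Ω Ω₁ Ω₂ : Set Plane) (T : Finset (Finset Plane)) : Submodule ℝ (XSpace Ω₁ Ω₂) where
  carrier := {x | x.fst ∈ RT0 Ω₁ T ∧ x.snd ∈ QPressure Ω Ω₂ T}
  zero_mem' := ⟨zero_mem _, zero_mem _⟩
  add_mem' := fun h h' => ⟨add_mem h.1 h'.1, add_mem h.2 h'.2⟩
  smul_mem' := fun r _ h => ⟨Submodule.smul_mem _ r h.1, Submodule.smul_mem _ r h.2⟩

/-- `Y_h = ∇Q(Ω₂) × Q(Ω₁)`. -/
def Yh (Ω Ω₁ Ω₂ : Set Plane) (T : Finset (Finset Plane)) : Submodule ℝ (YSpace Ω₁ Ω₂) where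
  carrier := {y | y.fst ∈ GradQ Ω Ω₂ T ∧ y.snd ∈ QConst Ω₁ T}
  zero_mem' := ⟨zero_mem _, zero_mem _⟩
  add_mem' := fun h h' => ⟨add_mem h.1 h'.1, add_mem h.2 h'.2⟩
  smul_mem' := fun r _ h => ⟨Submodule.smul_mem _ r h.1, Submodule.smul_mem _ r h.2⟩

section Components

variable {Ω Ω₁ Ω₂ : Set Plane} {T : Finset (Finset Plane)}

/-- The field `v₁` of `[v₁, q₂] ∈ X_h`. -/
def vel (x : Xh Ω Ω₁ Ω₂ T) : L2v Ω₁ := x.1.fst.1.fst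

/-- The weak divergence `∇ · v₁` of `[v₁, q₂] ∈ X_h`. -/
def divVel (x : Xh Ω Ω₁ Ω₂ T) : L2 Ω₁ := x.1.fst.1.snd

/-- The function `q₂` of `[v₁, q₂] ∈ X_h`. -/
def pres (x : Xh Ω Ω₁ Ω₂ T) : L2 Ω₂ := x.1.snd.1.fst

/-- The weak gradient `∇ q₂` of `[v₁, q₂] ∈ X_h`. -/
def gradPres (x : Xh Ω Ω₁ Ω₂ T) : L2v Ω₂ := x.1.snd.1.snd

end Components

/-! ### The discrete operators -/

/-- The trace of `f` on `∂U`, taken from inside `U`, by the usual pointwise formula: the limit of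
the averages of `f` over `U ∩ ball x r` as `r → 0`. -/
def trace {F : Type*} [NormedAddCommGroup F] [NormedSpace ℝ F] (U : Set Plane) (f : Plane → F)
    (x : Plane) : F :=
  limUnder (𝓝[>] (0 : ℝ)) fun r => ⨍ y in ball x r ∩ U, f y

/-- The form `A_h [v₁, q₂] ([w₁, r₂])`. The unit normal on the interface is the outer normal of
`Ω₁`. Since the members of `X_h` are piecewise polynomial, their traces are honest functions on
the interface and the duality pairing of a normal trace with a trace is an integral. -/
def formA (a β : Plane → ℝ) (Γ : Set Plane) {Ω Ω₁ Ω₂ : Set Plane} {T : Finset (Finset Plane)}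
    (x y : Xh Ω Ω₁ Ω₂ T) : ℝ :=
  (∫ s in Ω₁, a s * inner ℝ (vel x s) (vel y s))
    + (∫ s, β s * trace Ω₂ (pres x) s * trace Ω₂ (pres y) s ∂(surfaceMeasure Γ))
    - (∫ s, inner ℝ (trace Ω₁ (vel x) s) (outerNormal Ω₁ s) * trace Ω₂ (pres y) s
        ∂(surfaceMeasure Γ))
    + ∫ s, trace Ω₂ (pres x) s * inner ℝ (trace Ω₁ (vel y) s) (outerNormal Ω₁ s)
        ∂(surfaceMeasure Γ)

/-- The form `B_h [v₁, q₂] ([w₂, r₁])`. -/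
def formB {Ω Ω₁ Ω₂ : Set Plane} {T : Finset (Finset Plane)} (x : Xh Ω Ω₁ Ω₂ T)
    (y : Yh Ω Ω₁ Ω₂ T) : ℝ :=
  (∫ s in Ω₁, divVel x s * y.1.snd s) + ∫ s in Ω₂, inner ℝ (gradPres x s) (y.1.fst s)

/-- The kernel of `B_h : X_h → Y_h'`. -/
def kerB (Ω Ω₁ Ω₂ : Set Plane) (T : Finset (Finset Plane)) : Set (Xh Ω Ω₁ Ω₂ T) :=
  {x | ∀ y : Yh Ω Ω₁ Ω₂ T, formB x y = 0}

/-! ### Coefficients -/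

/-- The hypothesis on the coefficients: `a : Ω → (0, ∞)` with `a, 1/a ∈ L^∞(Ω)`, and
`β : Γ → [0, ∞)` with `β ∈ L^∞(Γ)` and `‖β‖_{L¹(Γ)} > 0`. -/
structure CoefficientHypothesis (Ω Γ : Set Plane) (a β : Plane → ℝ) : Prop where
  a_pos : ∀ x ∈ Ω, 0 < a x
  a_bounded : MemLp a ∞ ((volume : Measure Plane).restrict Ω)
  inv_a_bounded : MemLp (fun x => 1 / a x) ∞ ((volume : Measure Plane).restrict Ω)
  β_nonneg : ∀ x ∈ Γ, 0 ≤ β x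
  β_bounded : MemLp β ∞ (surfaceMeasure Γ)
  β_pos : 0 < eLpNorm β 1 (surfaceMeasure Γ)

/-- `min {‖1/a‖_{L^∞(Ω)}⁻¹, ‖β‖_{L¹(Γ)} / |Ω₂|}`. -/
def coercivityConst (Ω Ω₂ Γ : Set Plane) (a β : Plane → ℝ) : ℝ :=
  min ((eLpNorm (fun x => 1 / a x) ∞ ((volume : Measure Plane).restrict Ω)).toReal)⁻¹
    ((eLpNorm β 1 (surfaceMeasure Γ)).toReal / (volume Ω₂).toReal)

end PrimalDual

end

open PrimalDual

noncomputable section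

namespace PrimalDual

open MeasureTheory Metric Set Filter Topology
open scoped ENNReal ContDiff Convolution

/-! ### Sectors and polygons -/

/-! Kernel. An element of `kerB` can be tested with its own pair [∇q₂, ∇·v₁]. This pair lies in Y_h,
because on each triangle the weak gradient of an affine function and the weak divergence of a
Raviart-Thomas field are constant (`gradPres_mem_GradQ`, `divVel_mem_QConst`). Hence ‖∇·v₁‖² +
‖∇q₂‖² = 0, and q₂ is constant on each polygon G²_j.

The delicate point is that these constants agree. Two polygons of Ω₂ may touch only at a vertex, so
connectedness of the closure of Ω₂ alone does not suffice; here the extension ξ ∈ H¹(Ω) of q₂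
enters. Let p be a common point of two closures. Near p the set Ω is a connected cone, or a disc,
even when p ∈ ∂Ω. Mollify ξ at radius cε at two points contracted to p by the factor c. In the plane
the Dirichlet energy is scale invariant, so the difference of the two values is bounded, uniformly
in c, by the square root of the energy of ξ in a ball of radius O(c) about p, and this tends to 0
with c. If the two points start in the two polygons, the mollified values are the two constants,
which are therefore equal (`IsWeakGrad.eq_of_closure_inter`). A connectedness argument on the
finitely many closures then gives a single constant c.

Coercivity. In A_h(x, x) the two coupling terms cancel, leaving ∫ a|v₁|² + ∫ β q₂². On the kernel
the trace of q₂ is c throughout Γ, because Γ lies in the closure of Ω₂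
(`GeometricHypothesis.interface_subset`). The second term is then ‖β‖₁c², while ‖q₂‖² = |Ω₂|c².

Continuity. X_h is finite dimensional (`finiteDimensional_Xh`), so only bilinearity has to be shown.
Traces are limits of averages, hence linear once the limits exist. They exist because the triangles
tile each region and a convex open set has a density at every point (`Convex.exists_density`).
Measurability and boundedness of traces and normal make the interface integrals converge. The tiling
itself needs that a triangle missing one region lies in the other, which holds because boundaries
within one colour class share no length (`subset_iUnion_of_disjoint`). -/

/-- The unit vector of angle `θ`. -/
def dir (θ : ℝ) : Plane := !₂[Real.cos θ, Real.sin θ]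

theorem continuous_dir : Continuous dir := by
  unfold dir
  refine (PiLp.continuous_toLp 2 _).comp (continuous_pi fun i => ?_)
  fin_cases i
  · exact Real.continuous_cos
  · exact Real.continuous_sin

theorem norm_dir (θ : ℝ) : ‖dir θ‖ = 1 := by
  rw [EuclideanSpace.norm_eq]
  simp [dir, Fin.sum_univ_two]

theorem norm_smul_dir {ρ : ℝ} (h : 0 ≤ ρ) (θ : ℝ) : ‖ρ • dir θ‖ = ρ := by
  rw [norm_smul, norm_dir, mul_one, Real.norm_of_nonneg h]

theorem dir_eq {θ ψ : ℝ} (h : dir θ = dir ψ) : ∃ n : ℤ, θ - ψ = 2 * Real.pi * n := by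
  have h0 := congrArg (fun v : Plane => v 0) h
  have h1 := congrArg (fun v : Plane => v 1) h
  simp only [dir, PiLp.toLp_apply, Matrix.cons_val_zero, Matrix.cons_val_one] at h0 h1
  exact Real.Angle.angle_eq_iff_two_pi_dvd_sub.1 (Real.Angle.cos_sin_inj h0 h1)

theorem dir_ne {θ ψ : ℝ} (h0 : 0 < θ - ψ) (h1 : θ - ψ < 2 * Real.pi) : dir θ ≠ dir ψ := by
  intro h
  obtain ⟨n, hn⟩ := dir_eq h
  have hpi := Real.two_pi_pos
  have a : (0 : ℝ) < n := by
    by_contra! hneg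
    nlinarith
  have b : (n : ℝ) < 1 := by
    by_contra! hge
    nlinarith
  have a' : 0 < n := by exact_mod_cast a
  have b' : n < 1 := by exact_mod_cast b
  omega

theorem smul_dir_inj {ρ σ θ ψ : ℝ} (hρ : 0 < ρ) (hσ : 0 ≤ σ) (h : ρ • dir θ = σ • dir ψ) :
    ρ = σ ∧ dir θ = dir ψ := by
  have h1 : ρ = σ := by
    rw [← norm_smul_dir hρ.le θ, h, norm_smul_dir hσ]
  subst h1
  exact ⟨rfl, smul_right_injective Plane hρ.ne' h⟩

theorem mem_sector {x y : Plane} {r α γ : ℝ} : y ∈ sector x r α γ ↔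
    ∃ ρ θ : ℝ, 0 < ρ ∧ ρ < r ∧ α < θ ∧ θ < α + γ ∧ y = x + ρ • dir θ := Iff.rfl

theorem sector_eq_image (x : Plane) (r α γ : ℝ) : sector x r α γ =
    (fun p : ℝ × ℝ => x + p.1 • dir p.2) '' (Ioo 0 r ×ˢ Ioo α (α + γ)) := by
  ext y
  simp only [mem_sector, mem_image, mem_prod, mem_Ioo, Prod.exists]
  constructor
  · rintro ⟨ρ, θ, h1, h2, h3, h4, rfl⟩
    exact ⟨ρ, θ, ⟨⟨h1, h2⟩, h3, h4⟩, rfl⟩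
  · rintro ⟨ρ, θ, ⟨⟨h1, h2⟩, h3, h4⟩, rfl⟩
    exact ⟨ρ, θ, h1, h2, h3, h4, rfl⟩

theorem continuous_polar (x : Plane) : Continuous fun p : ℝ × ℝ => x + p.1 • dir p.2 := by
  have := continuous_dir
  fun_prop

theorem isPreconnected_sector (x : Plane) (r α γ : ℝ) : IsPreconnected (sector x r α γ) := by
  rw [sector_eq_image]
  exact (isPreconnected_Ioo.prod isPreconnected_Ioo).image _ (continuous_polar x).continuousOn

/-- The closed polar rectangle is compact, so its image is closed and contains the sector. -/
theorem closure_sector_subset (x : Plane) (r α γ : ℝ) : closure (sector x r α γ) ⊆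
    (fun p : ℝ × ℝ => x + p.1 • dir p.2) '' (Icc 0 r ×ˢ Icc α (α + γ)) := by
  rw [sector_eq_image]
  refine closure_minimal (image_mono (prod_mono Ioo_subset_Icc_self Ioo_subset_Icc_self)) ?_
  exact ((isCompact_Icc.prod isCompact_Icc).image (continuous_polar x)).isClosed

/-- Sectors are star-shaped cones. -/
theorem sector_scale {x y : Plane} {r α γ c : ℝ} (hy : y ∈ sector x r α γ) (hc : 0 < c)
    (hc1 : c ≤ 1) : x + c • (y - x) ∈ sector x r α γ := by
  obtain ⟨ρ, θ, h1, h2, h3, h4, rfl⟩ := hy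
  refine ⟨c * ρ, θ, by positivity, by nlinarith, h3, h4, ?_⟩
  simp [smul_smul]

/-- The point `x + ρ • dir α` on the initial side of a sector is in the closure of the sector. -/
theorem side_mem_closure {x : Plane} {r α γ ρ : ℝ} (hγ : 0 < γ) (h0 : 0 < ρ) (h1 : ρ < r) :
    x + ρ • dir α ∈ closure (sector x r α γ) := by
  have hc : Continuous fun θ => x + ρ • dir θ := by
    have := continuous_dir
    fun_prop
  have h2 : α ∈ closure (Ioo α (α + γ)) := by
    rw [closure_Ioo (by linarith)]
    exact ⟨le_rfl, by linarith⟩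
  have h3 := mem_closure_image (f := fun θ => x + ρ • dir θ) hc.continuousAt h2
  refine closure_mono ?_ h3
  rintro _ ⟨θ, ⟨h4, h5⟩, rfl⟩
  exact ⟨ρ, θ, h0, h1, h4, h5, rfl⟩

/-- An opening below 2π keeps the angles of the sector from wrapping around to the initial side. -/
theorem side_notMem {x : Plane} {r α γ ρ : ℝ} (hγ : γ < 2 * Real.pi) (h0 : 0 < ρ) :
    x + ρ • dir α ∉ sector x r α γ := by
  rintro ⟨σ, θ, h1, h2, h3, h4, h5⟩
  obtain ⟨-, h6⟩ := smul_dir_inj h1 h0.le (add_left_cancel h5).symm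
  exact dir_ne (by linarith) (by linarith) h6

/-! ### Local structure of the boundary of a polygon -/

namespace IsPolygon

variable {U : Set Plane} (hU : IsPolygon U)
include hU

theorem frontier_eq : frontier U = closure U \ U := by
  rw [frontier, hU.isOpen.interior_eq]

/-- Arbitrarily close to each boundary point of a polygon there are exterior points. -/
theorem mem_closure_compl {x : Plane} (hx : x ∈ frontier U) : x ∈ closure (closure U)ᶜ := by
  obtain ⟨r, α, γ, hr, hγ, hγ2, hs⟩ := hU.locally_sector x hx
  rw [Metric.mem_closure_iff]
  intro ε hε
  set ρ := min ε r / 2 with hρ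
  have hρ0 : 0 < ρ := by positivity
  have hρe : ρ < ε := by have := min_le_left ε r; linarith [lt_min hε hr]
  have hρr : ρ < r := by have := min_le_right ε r; linarith [lt_min hε hr]
  -- The bisector of the complementary angle, which is positive since γ < 2π.
  set ψ := α + γ + (2 * Real.pi - γ) / 2 with hψ
  have hd : dist (x + ρ • dir ψ) x = ρ := by
    rw [dist_eq_norm, add_sub_cancel_left, norm_smul_dir hρ0.le]
  refine ⟨x + ρ • dir ψ, fun hmem => ?_, by rw [dist_comm, hd]; exact hρe⟩
  have h1 : x + ρ • dir ψ ∈ closure (U ∩ ball x r) := by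
    refine isOpen_ball.closure_inter ⟨hmem, ?_⟩
    rw [mem_ball, hd]
    exact hρr
  rw [hs] at h1
  obtain ⟨⟨σ, θ⟩, ⟨⟨h2, h3⟩, h4, h5⟩, h6⟩ := closure_sector_subset _ _ _ _ h1
  obtain ⟨-, h7⟩ := smul_dir_inj hρ0 h2 (add_left_cancel h6).symm
  simp only at h4 h5
  exact dir_ne (by linarith) (by linarith) h7

/-- A boundary point is a limit of exterior points, so it cannot be interior to the closure. This
places the open triangles inside Ω although the triangulation covers only the closure of Ω. -/
theorem interior_closure_subset : interior (closure U) ⊆ U := by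
  intro x hx
  by_contra hxU
  have h1 : x ∈ frontier U := hU.frontier_eq ▸ ⟨interior_subset hx, hxU⟩
  obtain ⟨y, hy, hy'⟩ := _root_.mem_closure_iff.1 (hU.mem_closure_compl h1) _ isOpen_interior hx
  exact hy' (interior_subset hy)

/-- The boundary of a polygon is, near each of its points, contained in two segments. -/
theorem hausdorffMeasure_frontier_lt_top : μH[1] (frontier U) < ⊤ := by
  have hcpt : IsCompact (frontier U) := by
    refine hU.isBounded.isCompact_closure.of_isClosed_subset isClosed_frontier
      frontier_subset_closure
  refine hcpt.measure_lt_top_of_nhdsWithin fun x hx => ?_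
  obtain ⟨r, α, γ, hr, hγ, hγ2, hs⟩ := hU.locally_sector x hx
  refine ⟨frontier U ∩ ball x r, inter_mem self_mem_nhdsWithin
    (mem_nhdsWithin_of_mem_nhds (ball_mem_nhds x hr)), ?_⟩
  have hsub : frontier U ∩ ball x r ⊆
      segment ℝ x (x + r • dir α) ∪ segment ℝ x (x + r • dir (α + γ)) := by
    rintro y ⟨hy, hyr⟩
    rw [hU.frontier_eq] at hy
    have h1 : y ∈ closure (U ∩ ball x r) := isOpen_ball.closure_inter ⟨hy.1, hyr⟩
    have h2 : y ∉ sector x r α γ := fun h => by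
      rw [← hs] at h
      exact hy.2 h.1
    rw [hs] at h1
    obtain ⟨⟨σ, θ⟩, ⟨⟨h3, h4⟩, h5, h6⟩, rfl⟩ := closure_sector_subset _ _ _ _ h1
    simp only at h3 h4 h5 h6 h2 hyr ⊢
    have key : ∀ ψ, x + σ • dir ψ ∈ segment ℝ x (x + r • dir ψ) := by
      intro ψ
      rw [segment_eq_image']
      refine ⟨σ / r, ⟨by positivity, (div_le_one hr).2 h4⟩, ?_⟩
      simp only [add_sub_cancel_left, smul_smul]
      rw [div_mul_cancel₀ _ hr.ne']
    rcases h3.eq_or_lt with h0 | h0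
    · left
      rw [← h0, zero_smul, add_zero]
      exact left_mem_segment ℝ _ _
    have hσr : σ < r := by
      rwa [mem_ball, dist_eq_norm, add_sub_cancel_left, norm_smul_dir h3] at hyr
    rcases h5.eq_or_lt with h7 | h7
    · left
      rw [h7]
      exact key _
    rcases h6.eq_or_lt with h8 | h8
    · right
      rw [h8]
      exact key _
    exact absurd ⟨σ, θ, h0, hσr, h7, h8, rfl⟩ h2
  refine (measure_mono hsub).trans_lt ((measure_union_le _ _).trans_lt ?_)
  simp [hausdorffMeasure_segment, edist_lt_top]

/-- The boundary of a polygon has positive length near each of its points. -/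
theorem hausdorffMeasure_frontier_inter_pos {x : Plane} (hx : x ∈ frontier U) {V : Set Plane}
    (hV : V ∈ 𝓝 x) : 0 < μH[1] (frontier U ∩ V) := by
  obtain ⟨r, α, γ, hr, hγ, hγ2, hs⟩ := hU.locally_sector x hx
  obtain ⟨ε, hε, hεV⟩ := Metric.mem_nhds_iff.1 hV
  set ρ := min ε r with hρ
  have hρ0 : 0 < ρ := lt_min hε hr
  -- A piece of the initial side of the sector, away from the apex and inside both balls, of
  -- positive length.
  have hsub : segment ℝ (x + (ρ / 4) • dir α) (x + (ρ / 2) • dir α) ⊆ frontier U ∩ V := by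
    rw [segment_eq_image']
    rintro _ ⟨t, ⟨ht0, ht1⟩, rfl⟩
    have h1 : x + (ρ / 4) • dir α + t • (x + (ρ / 2) • dir α - (x + (ρ / 4) • dir α)) =
        x + (ρ / 4 * (1 + t)) • dir α := by
      module
    have h0 : 0 < ρ / 4 * (1 + t) := by positivity
    have h2 : ρ / 4 * (1 + t) < ρ := by nlinarith
    have h3 : ρ / 4 * (1 + t) < r := h2.trans_le (min_le_right _ _)
    have hd : dist (x + (ρ / 4 * (1 + t)) • dir α) x = ρ / 4 * (1 + t) := by
      rw [dist_eq_norm, add_sub_cancel_left, norm_smul_dir h0.le]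
    simp only [h1]
    refine ⟨?_, hεV ?_⟩
    · rw [hU.frontier_eq]
      refine ⟨closure_mono (hs ▸ inter_subset_left) (side_mem_closure hγ h0 h3), fun h => ?_⟩
      have hmem : x + (ρ / 4 * (1 + t)) • dir α ∈ U ∩ ball x r :=
        ⟨h, by rw [mem_ball, hd]; exact h3⟩
      exact side_notMem hγ2 h0 (hs ▸ hmem)
    · rw [mem_ball, hd]
      exact h2.trans_le (min_le_left _ _)
  refine lt_of_lt_of_le ?_ (measure_mono hsub)
  rw [hausdorffMeasure_segment, edist_pos]
  intro h
  have := (smul_dir_inj (by positivity) (by positivity) (add_left_cancel h)).1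
  linarith

end IsPolygon

/-- An open set that misses one colour class of a map made of polygons is contained in the union
of the other colour class, whose members share no boundary of positive length. -/
theorem subset_iUnion_of_disjoint {ι κ : Type*} [Finite ι] [Finite κ] {W t : Set Plane}
    {F : ι → Set Plane} {H : κ → Set Plane} (hF : ∀ i, IsPolygon (F i))
    (hdis : ∀ i k, i ≠ k → F i ∩ F k = ∅)
    (hnull : ∀ i k, i ≠ k → μH[1] (frontier (F i) ∩ frontier (F k)) = 0)
    (hcov : closure W ⊆ (⋃ i, closure (F i)) ∪ ⋃ j, closure (H j))
    (ht : IsOpen t) (htW : t ⊆ W) (hd : t ∩ ⋃ j, H j = ∅) : t ⊆ ⋃ i, F i := by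
  -- An open set that misses every `H j` also misses their closures.
  have hcl : ∀ s ∈ t, ∃ i, s ∈ closure (F i) := by
    intro s hs
    rcases hcov (subset_closure (htW hs)) with h | h
    · exact mem_iUnion.1 h
    · obtain ⟨j, hj⟩ := mem_iUnion.1 h
      obtain ⟨y, hy, hy'⟩ := _root_.mem_closure_iff.1 hj t ht hs
      exact absurd (hd ▸ ⟨hy, mem_iUnion.2 ⟨j, hy'⟩⟩ : y ∈ (∅ : Set Plane)) (notMem_empty y)
  intro s hs
  by_contra hsF
  obtain ⟨i, hi⟩ := hcl s hs
  have hfr : s ∈ frontier (F i) := by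
    rw [(hF i).frontier_eq]
    exact ⟨hi, fun h => hsF (mem_iUnion.2 ⟨i, h⟩)⟩
  have hpos := (hF i).hausdorffMeasure_frontier_inter_pos hfr (ht.mem_nhds hs)
  -- Exterior points of `F i` accumulate at each of its boundary points in `t`, and they lie in
  -- closures of other members. So inside `t` the boundary of `F i` is wholly shared and has length
  -- zero, against `hpos`.
  have hsub : frontier (F i) ∩ t ⊆ ⋃ k : {k // k ≠ i}, frontier (F i) ∩ frontier (F k) := by
    rintro y ⟨hy, hyt⟩
    have h1 : y ∈ closure (⋃ k : {k // k ≠ i}, closure (F k)) := by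
      rw [_root_.mem_closure_iff]
      intro o ho hyo
      obtain ⟨z, ⟨hzo, hzt⟩, hz⟩ := _root_.mem_closure_iff.1 ((hF i).mem_closure_compl hy) (o ∩ t)
        (ho.inter ht) ⟨hyo, hyt⟩
      obtain ⟨k, hk⟩ := hcl z hzt
      exact ⟨z, hzo, mem_iUnion.2 ⟨⟨k, fun h => hz (h ▸ hk)⟩, hk⟩⟩
    rw [(isClosed_iUnion_of_finite fun k : {k // k ≠ i} => isClosed_closure).closure_eq] at h1
    obtain ⟨k, hk⟩ := mem_iUnion.1 h1
    refine mem_iUnion.2 ⟨k, hy, ?_⟩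
    rw [(hF k).frontier_eq]
    refine ⟨hk, fun hyk => ?_⟩
    rw [(hF i).frontier_eq] at hy
    obtain ⟨z, hz, hz'⟩ := _root_.mem_closure_iff.1 hy.1 _ (hF k).isOpen hyk
    exact absurd (hdis k i k.2 ▸ ⟨hz, hz'⟩ : z ∈ (∅ : Set Plane)) (notMem_empty z)
  refine hpos.ne' (measure_mono_null hsub ?_)
  rw [measure_iUnion_null_iff]
  exact fun k => hnull _ _ k.2.symm

/-! ### Consequences of the geometric hypothesis -/

theorem isOpen_region {I : ℕ} {G : Fin I → Set Plane} (h : ∀ i, IsPolygon (G i)) :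
    IsOpen (region G) := isOpen_iUnion fun i => (h i).isOpen

/-- The triangles of a triangulation are open and convex. -/
theorem isOpen_triangle (t : Finset Plane) : IsOpen (triangle t) := isOpen_interior

theorem convex_triangle (t : Finset Plane) : Convex ℝ (triangle t) :=
  (convex_convexHull ℝ _).interior

namespace GeometricHypothesis

variable {I J : ℕ} {Ω : Set Plane} {G₁ : Fin I → Set Plane} {G₂ : Fin J → Set Plane}
  (hΩ : GeometricHypothesis Ω G₁ G₂)
include hΩ

theorem region₁_subset : region G₁ ⊆ Ω := iUnion_subset fun i => hΩ.map.subset (Sum.inl i)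

theorem region₂_subset : region G₂ ⊆ Ω := iUnion_subset fun j => hΩ.map.subset (Sum.inr j)

theorem isOpen_region₁ : IsOpen (region G₁) := isOpen_region hΩ.polygon₁

theorem isOpen_region₂ : IsOpen (region G₂) := isOpen_region hΩ.polygon₂

theorem closure_subset : closure Ω ⊆ (⋃ i, closure (G₁ i)) ∪ ⋃ j, closure (G₂ j) := by
  rw [hΩ.map.closure_eq, iUnion_sum]
  rfl

theorem disjoint₁ (i k : Fin I) (h : i ≠ k) : G₁ i ∩ G₁ k = ∅ :=
  hΩ.map.disjoint (Sum.inl i) (Sum.inl k) (by simpa using h)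

theorem disjoint₂ (i k : Fin J) (h : i ≠ k) : G₂ i ∩ G₂ k = ∅ :=
  hΩ.map.disjoint (Sum.inr i) (Sum.inr k) (by simpa using h)

theorem subset_region₁ {t : Set Plane} (ht : IsOpen t) (htΩ : t ⊆ Ω) (hd : t ∩ region G₂ = ∅) :
    t ⊆ region G₁ :=
  subset_iUnion_of_disjoint hΩ.polygon₁ hΩ.disjoint₁ hΩ.map.frontier₁ hΩ.closure_subset ht htΩ hd

theorem subset_region₂ {t : Set Plane} (ht : IsOpen t) (htΩ : t ⊆ Ω) (hd : t ∩ region G₁ = ∅) :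
    t ⊆ region G₂ :=
  subset_iUnion_of_disjoint hΩ.polygon₂ hΩ.disjoint₂ hΩ.map.frontier₂
    (hΩ.closure_subset.trans (union_comm _ _).subset) ht htΩ hd

theorem region₁_inter_region₂ : region G₁ ∩ region G₂ = ∅ := by
  refine Set.eq_empty_of_forall_notMem ?_
  rintro x ⟨h1, h2⟩
  obtain ⟨i, hi⟩ := mem_iUnion.1 h1
  obtain ⟨j, hj⟩ := mem_iUnion.1 h2
  exact absurd (hΩ.map.disjoint (Sum.inl i) (Sum.inr j) (by simp) ▸ ⟨hi, hj⟩ :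
    x ∈ (∅ : Set Plane)) (notMem_empty x)

/-- Each point of the interface is in the closure of the second region. -/
theorem interface_subset : interface Ω G₁ G₂ ⊆ closure (region G₂) := by
  rintro s ⟨hs, hsΩ⟩
  obtain ⟨n, hn⟩ := mem_iUnion.1 hs
  have h1 : s ∈ closure Ω := by
    rw [hΩ.map.closure_eq]
    exact mem_iUnion.2 ⟨n, frontier_subset_closure hn⟩
  have h2 : s ∈ Ω := by
    by_contra h
    exact hsΩ (hΩ.domain.frontier_eq ▸ ⟨h1, h⟩)
  by_contra hcl
  -- Away from the second closure, Ω consists of points of the open pieces of the first colour,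
  -- whereas an interface point lies in no piece of that colour.
  have h3 : Ω \ closure (region G₂) ⊆ region G₁ := by
    refine hΩ.subset_region₁ (hΩ.domain.isOpen.sdiff isClosed_closure) sdiff_subset ?_
    refine Set.eq_empty_of_forall_notMem ?_
    rintro x ⟨h, h'⟩
    exact h.2 (subset_closure h')
  obtain ⟨i, hi⟩ := mem_iUnion.1 (h3 ⟨h2, hcl⟩)
  have hop : IsOpen (Sum.elim G₁ G₂ (Sum.inl i)) := hΩ.map.isOpen _
  obtain ⟨y, hy, hy'⟩ := _root_.mem_closure_iff.1 (frontier_subset_closure hn) _ hop hi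
  by_cases hni : Sum.inl i = n
  · subst hni
    rw [frontier, hop.interior_eq] at hn
    exact hn.2 hi
  · exact absurd (hΩ.map.disjoint _ _ hni ▸ ⟨hy, hy'⟩ : y ∈ (∅ : Set Plane)) (notMem_empty y)

omit hΩ in
theorem measurableSet_interface : MeasurableSet (interface Ω G₁ G₂) :=
  (MeasurableSet.iUnion fun _ => isClosed_frontier.measurableSet).diff
    isClosed_frontier.measurableSet

theorem isFiniteMeasure_surfaceMeasure :
    IsFiniteMeasure (surfaceMeasure (interface Ω G₁ G₂)) := by
  constructor
  rw [surfaceMeasure, Measure.restrict_apply_univ]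
  refine (measure_mono sdiff_subset).trans_lt ((measure_iUnion_le _).trans_lt ?_)
  rw [tsum_fintype, ENNReal.sum_lt_top]
  rintro (i | j) _
  · exact (hΩ.polygon₁ i).hausdorffMeasure_frontier_lt_top
  · exact (hΩ.polygon₂ j).hausdorffMeasure_frontier_lt_top

theorem triangle_subset {T : Finset (Finset Plane)} (hT : IsTriangulation Ω T) {t : Finset Plane}
    (ht : t ∈ T) : triangle t ⊆ Ω := by
  refine (interior_mono ?_).trans hΩ.domain.interior_closure_subset
  rw [← hT.covers]
  exact subset_biUnion_of_mem (u := fun t : Finset Plane => convexHull ℝ (t : Set Plane)) ht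

/-- Consistency only says that a triangle misses one region. Containment in the other also excludes
that it crosses an edge between two polygons of the same colour. -/
theorem triangle_subset_or {T : Finset (Finset Plane)} (hT : IsTriangulation Ω T)
    (hcons : IsConsistent T (region G₁) (region G₂)) {t : Finset Plane} (ht : t ∈ T) :
    triangle t ⊆ region G₁ ∨ triangle t ⊆ region G₂ := by
  rcases hcons t ht with h | h
  · exact Or.inr (hΩ.subset_region₂ (isOpen_triangle t) (hΩ.triangle_subset hT ht) h)
  · exact Or.inl (hΩ.subset_region₁ (isOpen_triangle t) (hΩ.triangle_subset hT ht) h)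

end GeometricHypothesis

/-! ### Tilings -/

/-- `U` is the disjoint union, up to a null set, of the convex open sets `K i` for `i ∈ s`. -/
structure IsTiling {ι : Type*} (U : Set Plane) (s : Finset ι) (K : ι → Set Plane) : Prop where
  isOpen_set : IsOpen U
  isBounded_set : Bornology.IsBounded U
  isOpen : ∀ i ∈ s, IsOpen (K i)
  convex : ∀ i ∈ s, Convex ℝ (K i)
  nonempty : ∀ i ∈ s, (K i).Nonempty
  subset : ∀ i ∈ s, K i ⊆ U
  disjoint : (s : Set ι).PairwiseDisjoint K
  null_diff : volume (U \ ⋃ i ∈ s, K i) = 0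

theorem IsTriangulation.nonempty_triangle {Ω : Set Plane} {T : Finset (Finset Plane)}
    (hT : IsTriangulation Ω T) {t : Finset Plane} (ht : t ∈ T) : (triangle t).Nonempty := by
  rw [triangle, interior_convexHull_nonempty_iff_affineSpan_eq_top]
  have h1 := (hT.affineIndependent t ht).affineSpan_eq_top_iff_card_eq_finrank_add_one.2
    (by simp [hT.card t ht])
  simpa using h1

/-- By conformity the closed triangles meet in the hull of at most two vertices. Its affine span has
dimension at most one, so its interior is empty. -/
theorem IsTriangulation.disjoint_triangle {Ω : Set Plane} {T : Finset (Finset Plane)}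
    (hT : IsTriangulation Ω T) {s t : Finset Plane} (hs : s ∈ T) (ht : t ∈ T) (hst : s ≠ t) :
    Disjoint (triangle s) (triangle t) := by
  classical
  rw [Set.disjoint_iff_inter_eq_empty, triangle, triangle, ← interior_inter,
    hT.conforming s hs t ht, ← Set.not_nonempty_iff_eq_empty,
    interior_convexHull_nonempty_iff_affineSpan_eq_top, ← Finset.coe_inter]
  intro h
  have hlt : (s ∩ t).card < 3 := by
    by_contra! hge
    have h1 : s ∩ t = s := Finset.eq_of_subset_of_card_le Finset.inter_subset_left
      (by rw [hT.card s hs]; exact hge)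
    have h2 : s ∩ t = t := Finset.eq_of_subset_of_card_le Finset.inter_subset_right
      (by rw [hT.card t ht]; exact hge)
    exact hst (h1.symm.trans h2)
  have hne : (s ∩ t).Nonempty := by
    rw [Finset.nonempty_iff_ne_empty]
    intro h0
    rw [h0, Finset.coe_empty, AffineSubspace.span_empty] at h
    exact bot_ne_top h
  have h3 := finrank_vectorSpan_image_finset_le ℝ (id : Plane → Plane) (s ∩ t)
    (n := (s ∩ t).card - 1) (by have := hne.card_pos; omega)
  rw [Finset.image_id] at h3
  rw [AffineSubspace.affineSpan_eq_top_iff_vectorSpan_eq_top_of_nonempty ℝ Plane Plane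
    (by exact_mod_cast hne)] at h
  rw [h, finrank_top, finrank_euclideanSpace_fin] at h3
  omega

/-- A point of `U` outside the triangles contained in `U` lies on the boundary of some closed
triangle: it cannot be interior to one contained in `V`. Boundaries of convex sets are null. -/
theorem IsTriangulation.isTiling {Ω U V : Set Plane} {T : Finset (Finset Plane)}
    (hT : IsTriangulation Ω T) (hU : IsOpen U) (hUb : Bornology.IsBounded U) (hUΩ : U ⊆ Ω)
    (hUV : U ∩ V = ∅) (hsub : ∀ t ∈ T, triangle t ⊆ U ∨ triangle t ⊆ V)
    [DecidablePred fun t => triangle t ⊆ U] :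
    IsTiling U (T.filter fun t => triangle t ⊆ U) triangle where
  isOpen_set := hU
  isBounded_set := hUb
  isOpen _ _ := isOpen_triangle _
  convex _ _ := convex_triangle _
  nonempty t ht := hT.nonempty_triangle (Finset.mem_filter.1 ht).1
  subset t ht := (Finset.mem_filter.1 ht).2
  disjoint s hs t ht hst := by
    exact hT.disjoint_triangle (Finset.mem_filter.1 hs).1 (Finset.mem_filter.1 ht).1 hst
  null_diff := by
    have h1 : U \ ⋃ t ∈ T.filter (fun t => triangle t ⊆ U), triangle t ⊆
        ⋃ t ∈ T, frontier (convexHull ℝ (t : Set Plane)) := by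
      rintro x ⟨hx, hx'⟩
      have hxc : x ∈ ⋃ t ∈ T, convexHull ℝ (t : Set Plane) := by
        rw [hT.covers]
        exact subset_closure (hUΩ hx)
      simp only [mem_iUnion, exists_prop, Finset.mem_filter, not_exists, not_and] at hxc hx' ⊢
      obtain ⟨t, ht, hxt⟩ := hxc
      refine ⟨t, ht, subset_closure hxt, fun hint => ?_⟩
      rcases hsub t ht with h | h
      · exact hx' t ⟨ht, h⟩ hint
      · exact absurd (hUV ▸ ⟨hx, h hint⟩ : x ∈ (∅ : Set Plane)) (notMem_empty x)
    refine measure_mono_null h1 ((measure_biUnion_null_iff T.countable_toSet).2 ?_)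
    exact fun t _ => (convex_convexHull ℝ _).addHaar_frontier _

/-! ### Densities of convex sets -/

theorem volume_ball_inter_lt_top (x : Plane) (r : ℝ) (K : Set Plane) :
    volume (ball x r ∩ K) < ⊤ := (measure_mono inter_subset_left).trans_lt measure_ball_lt_top

theorem volumeReal_ball_inter_le (x : Plane) {r : ℝ} (hr : 0 ≤ r) (K : Set Plane) :
    volume.real (ball x r ∩ K) ≤ r ^ 2 * Real.pi := by
  refine (measureReal_mono inter_subset_left measure_ball_lt_top.ne).trans_eq ?_
  rw [measureReal_def, EuclideanSpace.volume_ball_fin_two, ENNReal.toReal_mul, ENNReal.toReal_pow,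
    ENNReal.toReal_ofReal hr, ENNReal.toReal_ofReal Real.pi_pos.le]

/-- The area ratio of a convex open set in shrinking balls around a point of its closure is
monotone. -/
theorem Convex.antitoneOn_density {K : Set Plane} (hc : Convex ℝ K) (ho : IsOpen K) {x : Plane}
    (hx : x ∈ closure K) :
    AntitoneOn (fun r => volume.real (ball x r ∩ K) / r ^ 2) (Ioi 0) := by
  intro r hr s hs hrs
  simp only [mem_Ioi] at hr hs
  -- Contracting a convex open set towards a point of its closure keeps it inside itself. The
  -- contraction multiplies areas by (r/s)², which is the monotonicity of the ratio.
  have hsub : AffineMap.homothety x (r / s) '' (ball x s ∩ K) ⊆ ball x r ∩ K := by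
    rintro _ ⟨y, ⟨hy, hyK⟩, rfl⟩
    have h1 : AffineMap.homothety x (r / s) y = x + (r / s) • (y - x) := by
      simp [AffineMap.homothety_apply, add_comm]
    rw [h1]
    constructor
    · rw [mem_ball, dist_eq_norm] at hy ⊢
      rw [add_sub_cancel_left, norm_smul, Real.norm_of_nonneg (by positivity)]
      calc r / s * ‖y - x‖ < r / s * s := by gcongr
        _ = r := by field_simp
    · rcases hrs.eq_or_lt with h | h
      · rw [h, div_self hs.ne', one_smul, add_sub_cancel]
        exact hyK
      have h2 := hc.combo_closure_interior_mem_interior (a := 1 - r / s) (b := r / s) hx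
        (ho.interior_eq.symm ▸ hyK) (by rw [sub_nonneg, div_le_one hs]; exact hrs)
        (by positivity) (by ring)
      rw [ho.interior_eq] at h2
      convert h2 using 1
      module
  have h1 := measure_mono (μ := volume) hsub
  rw [Measure.addHaar_image_homothety, finrank_euclideanSpace_fin,
    abs_of_nonneg (by positivity)] at h1
  have h2 := ENNReal.toReal_mono (volume_ball_inter_lt_top x r K).ne h1
  rw [ENNReal.toReal_mul, ENNReal.toReal_ofReal (by positivity)] at h2
  simp only [← measureReal_def] at h2
  rw [div_le_div_iff₀ (by positivity) (by positivity)]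
  calc volume.real (ball x s ∩ K) * r ^ 2
      = (r / s) ^ 2 * volume.real (ball x s ∩ K) * s ^ 2 := by field_simp
    _ ≤ _ := by gcongr

theorem eventually_ball_inter_eq_empty {K : Set Plane} {x : Plane} (hx : x ∉ closure K) :
    ∀ᶠ r in 𝓝[>] (0 : ℝ), ball x r ∩ K = ∅ := by
  obtain ⟨ε, hε, h⟩ := Metric.isOpen_iff.1 isClosed_closure.isOpen_compl x hx
  filter_upwards [Ioo_mem_nhdsGT hε] with r hr
  refine Set.eq_empty_of_forall_notMem ?_
  rintro y ⟨hy, hyK⟩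
  exact h (ball_subset_ball hr.2.le hy) (subset_closure hyK)

/-- A convex open set has a density at each point, which is positive at the points of its
closure. -/
theorem Convex.exists_density {K : Set Plane} (hc : Convex ℝ K) (ho : IsOpen K)
    (x : Plane) : ∃ L : ℝ, 0 ≤ L ∧ (x ∈ closure K → 0 < L) ∧
      Tendsto (fun r => volume.real (ball x r ∩ K) / r ^ 2) (𝓝[>] 0) (𝓝 L) := by
  by_cases hx : x ∈ closure K
  · have hb : BddAbove ((fun r => volume.real (ball x r ∩ K) / r ^ 2) '' Ioi 0) := by
      refine ⟨Real.pi, ?_⟩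
      rintro _ ⟨r, hr, rfl⟩
      have hr0 : 0 < r := hr
      simp only
      rw [div_le_iff₀ (by positivity), mul_comm]
      exact volumeReal_ball_inter_le x hr0.le K
    -- The ratio increases as r decreases to 0, so the limit is the supremum, which is at least the
    -- positive ratio at r = 1.
    have hpos : 0 < sSup ((fun r => volume.real (ball x r ∩ K) / r ^ 2) '' Ioi 0) := by
      refine lt_of_lt_of_le ?_ (le_csSup hb ⟨1, mem_Ioi.2 one_pos, rfl⟩)
      simp only [one_pow, div_one]
      rw [measureReal_def, ENNReal.toReal_pos_iff]
      refine ⟨(isOpen_ball.inter ho).measure_pos _ ?_, volume_ball_inter_lt_top _ _ _⟩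
      exact _root_.mem_closure_iff.1 hx _ isOpen_ball (mem_ball_self one_pos)
    exact ⟨_, hpos.le, fun _ => hpos, (Convex.antitoneOn_density hc ho hx).tendsto_nhdsGT hb⟩
  · refine ⟨0, le_rfl, fun h => absurd h hx, ?_⟩
    refine tendsto_const_nhds.congr' ?_
    filter_upwards [eventually_ball_inter_eq_empty hx] with r hr
    simp [hr]

/-! ### Traces of piecewise continuous functions -/

section Trace

variable {F : Type*} [NormedAddCommGroup F] [NormedSpace ℝ F]

/-- On each piece, `f` agrees almost everywhere with a continuous function. -/
def IsPiecewiseContinuous {ι : Type*} (s : Finset ι) (K : ι → Set Plane) (f : Plane → F) : Prop :=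
  ∀ i ∈ s, ∃ p : Plane → F, Continuous p ∧ ∀ᵐ x ∂volume.restrict (K i), f x = p x

variable {ι : Type*} {U : Set Plane} {s : Finset ι} {K : ι → Set Plane} {f : Plane → F}

theorem IsTiling.volume_lt_top (h : IsTiling U s K) : volume U < ⊤ :=
  h.isBounded_set.measure_lt_top

theorem IsTiling.ae_of_forall (h : IsTiling U s K) {P : Plane → Prop}
    (hP : ∀ i ∈ s, ∀ᵐ x ∂volume.restrict (K i), P x) : ∀ᵐ x ∂volume.restrict U, P x := by
  rw [ae_restrict_iff' h.isOpen_set.measurableSet]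
  have h1 : ∀ᵐ x, ∀ i ∈ (s : Set ι), x ∈ K i → P x := (ae_ball_iff s.countable_toSet).2
    fun i hi => (ae_restrict_iff' (h.isOpen i hi).measurableSet).1 (hP i hi)
  have h2 : ∀ᵐ x, x ∉ U \ ⋃ i ∈ s, K i := measure_eq_zero_iff_ae_notMem.1 h.null_diff
  filter_upwards [h1, h2] with x hx hx' hxU
  by_contra hPx
  refine hx' ⟨hxU, ?_⟩
  simp only [mem_iUnion, not_exists]
  exact fun i hi hxi => hPx (hx i hi hxi)

omit [NormedSpace ℝ F] in
theorem IsTiling.exists_bound (h : IsTiling U s K) (hf : IsPiecewiseContinuous s K f) :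
    ∃ C : ℝ, 0 ≤ C ∧ ∀ᵐ x ∂volume.restrict U, ‖f x‖ ≤ C := by
  have h1 : ∀ i ∈ s, ∃ C : ℝ, ∀ᵐ x ∂volume.restrict (K i), ‖f x‖ ≤ C := by
    intro i hi
    obtain ⟨p, hp, hfp⟩ := hf i hi
    have hb : Bornology.IsBounded (K i) := h.isBounded_set.subset (h.subset i hi)
    obtain ⟨C, hC⟩ := hb.isCompact_closure.exists_bound_of_continuousOn hp.continuousOn
    refine ⟨C, ?_⟩
    filter_upwards [hfp, ae_restrict_mem (h.isOpen i hi).measurableSet] with x hx hxK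
    rw [hx]
    exact hC x (subset_closure hxK)
  choose! C hC using h1
  refine ⟨∑ i ∈ s, |C i|, Finset.sum_nonneg fun _ _ => abs_nonneg _, h.ae_of_forall ?_⟩
  intro i hi
  filter_upwards [hC i hi] with x hx
  exact hx.trans ((le_abs_self _).trans
    (Finset.single_le_sum (f := fun i => |C i|) (fun _ _ => abs_nonneg _) hi))

variable [CompleteSpace F]

/-- Replacing p by its value at x costs o(r²) in a ball of radius r; the remaining constant is
weighted by the density of `K`. -/
theorem tendsto_setIntegral_div {K : Set Plane} (hKb : Bornology.IsBounded K)
    {p : Plane → F} (hp : Continuous p) (x : Plane) {L : ℝ}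
    (hL : Tendsto (fun r => volume.real (ball x r ∩ K) / r ^ 2) (𝓝[>] 0) (𝓝 L)) :
    Tendsto (fun r => (r ^ 2)⁻¹ • ∫ y in ball x r ∩ K, p y) (𝓝[>] (0 : ℝ)) (𝓝 (L • p x)) := by
  have h1 : Tendsto (fun r => (r ^ 2)⁻¹ • ∫ y in ball x r ∩ K, (p y - p x)) (𝓝[>] (0 : ℝ))
      (𝓝 0) := by
    rw [Metric.tendsto_nhds]
    intro ε hε
    obtain ⟨δ, hδ, h⟩ := Metric.continuousAt_iff.1 hp.continuousAt (ε / (2 * Real.pi))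
      (by have := Real.pi_pos; positivity)
    filter_upwards [Ioo_mem_nhdsGT hδ] with r hr
    have hr0 : 0 < r := hr.1
    rw [dist_zero_right, norm_smul, norm_inv, Real.norm_of_nonneg (by positivity)]
    have h2 : ‖∫ y in ball x r ∩ K, (p y - p x)‖ ≤
        ε / (2 * Real.pi) * volume.real (ball x r ∩ K) := by
      refine norm_setIntegral_le_of_norm_le_const (volume_ball_inter_lt_top _ _ _) ?_
      intro y hy
      rw [← dist_eq_norm]
      exact (h ((mem_ball.1 hy.1).trans hr.2)).le
    have hpi := Real.pi_pos
    calc (r ^ 2)⁻¹ * ‖∫ y in ball x r ∩ K, (p y - p x)‖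
        ≤ (r ^ 2)⁻¹ * (ε / (2 * Real.pi) * (r ^ 2 * Real.pi)) := by
          gcongr
          refine h2.trans ?_
          gcongr
          exact volumeReal_ball_inter_le x hr0.le K
      _ = ε / 2 := by field_simp
      _ < ε := by linarith
  have h2 := h1.add (hL.smul_const (p x))
  rw [zero_add] at h2
  refine h2.congr fun r => ?_
  have hfin : volume (ball x r ∩ K) ≠ ⊤ := (volume_ball_inter_lt_top _ _ _).ne
  have hint : IntegrableOn p (ball x r ∩ K) := by
    refine (hp.continuousOn.integrableOn_compact hKb.isCompact_closure).mono_set ?_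
    exact inter_subset_right.trans subset_closure
  rw [integral_sub hint (integrableOn_const hfin), setIntegral_const, smul_sub, smul_smul,
    div_eq_inv_mul, sub_add_cancel]

omit [CompleteSpace F] in
theorem IsTiling.setIntegral_eq_sum (h : IsTiling U s K) {V : Set Plane} (hV : MeasurableSet V)
    (hf : IntegrableOn f U) :
    ∫ y in V ∩ U, f y = ∑ i ∈ s, ∫ y in V ∩ K i, f y := by
  rw [← integral_biUnion_finset s (fun i hi => hV.inter (h.isOpen i hi).measurableSet)
    (fun i hi j hj hij => (h.disjoint hi hj hij).mono inter_subset_right inter_subset_right)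
    (fun i hi => hf.mono_set (inter_subset_right.trans (h.subset i hi)))]
  refine setIntegral_congr_set ?_
  rw [← inter_iUnion₂]
  refine (ae_eq_refl V).inter ?_
  refine (LE.le.eventuallyLE ?_ |>.antisymm (ae_le_set.2 h.null_diff)).symm
  exact iUnion₂_subset h.subset

/-- The averages of a piecewise continuous function over shrinking balls converge at every
point. -/
theorem IsTiling.exists_tendsto_average (h : IsTiling U s K) (hf : IsPiecewiseContinuous s K f)
    (hint : IntegrableOn f U) (x : Plane) :
    ∃ L : F, Tendsto (fun r => ⨍ y in ball x r ∩ U, f y) (𝓝[>] (0 : ℝ)) (𝓝 L) := by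
  choose! L hL0 hLpos hL using fun i (hi : i ∈ s) =>
    Convex.exists_density (h.convex i hi) (h.isOpen i hi) x
  choose! p hp hfp using hf
  have hb : ∀ i ∈ s, Bornology.IsBounded (K i) := fun i hi => h.isBounded_set.subset (h.subset i hi)
  -- The average is the quotient of integral and area. Both are divided by r² and split over the
  -- pieces, so that each has a limit.
  have hA : Tendsto (fun r => (r ^ 2)⁻¹ • ∫ y in ball x r ∩ U, f y) (𝓝[>] (0 : ℝ))
      (𝓝 (∑ i ∈ s, L i • p i x)) := by
    refine (tendsto_finsetSum s fun i hi => tendsto_setIntegral_div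
      (hb i hi) (hp i hi) x (hL i hi)).congr fun r => ?_
    rw [h.setIntegral_eq_sum measurableSet_ball hint, Finset.smul_sum]
    refine Finset.sum_congr rfl fun i hi => ?_
    congr 1
    refine integral_congr_ae ?_
    filter_upwards [ae_restrict_of_ae_restrict_of_subset inter_subset_right (hfp i hi)] with y hy
    exact hy.symm
  have hB : Tendsto (fun r => volume.real (ball x r ∩ U) / r ^ 2) (𝓝[>] (0 : ℝ))
      (𝓝 (∑ i ∈ s, L i)) := by
    refine (tendsto_finsetSum s hL).congr fun r => ?_
    have h1 := h.setIntegral_eq_sum (f := fun _ => (1 : ℝ)) (V := ball x r) measurableSet_ball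
      (integrableOn_const h.volume_lt_top.ne)
    simp only [setIntegral_const, smul_eq_mul, mul_one] at h1
    rw [h1, Finset.sum_div]
  -- Zero total density means that x lies in the closure of no piece, by positivity of densities
  -- there; the averages then vanish for small r.
  by_cases h0 : ∑ i ∈ s, L i = 0
  · rw [Finset.sum_eq_zero_iff_of_nonneg hL0] at h0
    have hev : ∀ᶠ r in 𝓝[>] (0 : ℝ), ∀ i ∈ s, ball x r ∩ K i = ∅ := by
      rw [Filter.eventually_all_finset]
      intro i hi
      refine eventually_ball_inter_eq_empty fun hcl => ?_
      exact (hLpos i hi hcl).ne' (h0 i hi)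
    refine ⟨0, tendsto_const_nhds.congr' ?_⟩
    filter_upwards [hev] with r hr
    rw [setAverage_eq, h.setIntegral_eq_sum measurableSet_ball hint,
      Finset.sum_eq_zero fun i hi => by rw [hr i hi, setIntegral_empty], smul_zero]
  · refine ⟨_, ((hB.inv₀ h0).smul hA).congr' ?_⟩
    filter_upwards [self_mem_nhdsWithin] with r hr
    have hr0 : (0 : ℝ) < r := hr
    rw [setAverage_eq, smul_smul]
    congr 1
    field_simp

/-- `trace` is defined by `limUnder`, which carries no information unless a limit exists. Linearity,
measurability and bounds of traces all pass through this. -/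
theorem IsTiling.tendsto_trace (h : IsTiling U s K) (hf : IsPiecewiseContinuous s K f)
    (hint : IntegrableOn f U) (x : Plane) :
    Tendsto (fun r => ⨍ y in ball x r ∩ U, f y) (𝓝[>] (0 : ℝ)) (𝓝 (trace U f x)) :=
  tendsto_nhds_limUnder (h.exists_tendsto_average hf hint x)

theorem IsTiling.trace_add (h : IsTiling U s K) {g k : Plane → F}
    (hf : IsPiecewiseContinuous s K f) (hg : IsPiecewiseContinuous s K g)
    (hfi : IntegrableOn f U) (hgi : IntegrableOn g U)
    (hk : k =ᵐ[volume.restrict U] f + g) : trace U k = trace U f + trace U g := by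
  funext x
  refine Tendsto.limUnder_eq (((h.tendsto_trace hf hfi x).add (h.tendsto_trace hg hgi x)).congr ?_)
  intro r
  rw [setAverage_eq, setAverage_eq, setAverage_eq, ← smul_add,
    ← integral_add (hfi.mono_set inter_subset_right) (hgi.mono_set inter_subset_right)]
  congr 1
  refine integral_congr_ae ?_
  filter_upwards [ae_restrict_of_ae_restrict_of_subset inter_subset_right hk] with y hy
  exact hy.symm

theorem IsTiling.trace_smul (h : IsTiling U s K) {k : Plane → F} (c : ℝ)
    (hf : IsPiecewiseContinuous s K f) (hfi : IntegrableOn f U)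
    (hk : k =ᵐ[volume.restrict U] c • f) : trace U k = c • trace U f := by
  funext x
  refine Tendsto.limUnder_eq (((h.tendsto_trace hf hfi x).const_smul c).congr ?_)
  intro r
  rw [setAverage_eq, setAverage_eq, smul_comm, ← integral_smul]
  congr 1
  refine integral_congr_ae ?_
  filter_upwards [ae_restrict_of_ae_restrict_of_subset inter_subset_right hk] with y hy
  exact hy.symm

omit [CompleteSpace F] in
-- The set of pairs (x, y) with y ∈ `ball x r` is open, so this is measurability of a parametrised
-- integral on the product.
theorem stronglyMeasurable_setIntegral_ball (hU : MeasurableSet U) (hf : StronglyMeasurable f)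
    (r : ℝ) : StronglyMeasurable fun x => ∫ y in ball x r ∩ U, f y := by
  have hm : MeasurableSet {q : Plane × Plane | q.2 ∈ ball q.1 r} :=
    (isOpen_lt (continuous_snd.dist continuous_fst) continuous_const).measurableSet
  have h1 : StronglyMeasurable fun q : Plane × Plane =>
      {q : Plane × Plane | q.2 ∈ ball q.1 r}.indicator (fun q => U.indicator f q.2) q :=
    ((hf.indicator hU).comp_measurable measurable_snd).indicator hm
  have h2 := h1.integral_prod_right' (ν := volume)
  convert h2 using 1
  funext x
  rw [← integral_indicator (measurableSet_ball.inter hU), ← indicator_indicator]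
  rfl

/-- The averages are measurable in the centre and converge everywhere along a countably generated
filter. -/
theorem IsTiling.stronglyMeasurable_trace (h : IsTiling U s K) (hf : IsPiecewiseContinuous s K f)
    (hint : IntegrableOn f U) (hm : StronglyMeasurable f) : StronglyMeasurable (trace U f) := by
  refine stronglyMeasurable_of_tendsto (𝓝[>] (0 : ℝ))
    (f := fun r x => ⨍ y in ball x r ∩ U, f y) (fun r => ?_)
    (tendsto_pi_nhds.2 (h.tendsto_trace hf hint))
  have hU := h.isOpen_set.measurableSet
  have h1 := stronglyMeasurable_setIntegral_ball (f := fun _ => (1 : ℝ)) hU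
    stronglyMeasurable_const r
  simp only [setIntegral_const, smul_eq_mul, mul_one] at h1
  simp only [setAverage_eq]
  exact (h1.measurable.inv.stronglyMeasurable).smul (stronglyMeasurable_setIntegral_ball hU hm r)

theorem IsTiling.norm_trace_le (h : IsTiling U s K) (hf : IsPiecewiseContinuous s K f)
    (hint : IntegrableOn f U) {C : ℝ} (hC0 : 0 ≤ C) (hC : ∀ᵐ x ∂volume.restrict U, ‖f x‖ ≤ C)
    (x : Plane) : ‖trace U f x‖ ≤ C := by
  refine le_of_tendsto (h.tendsto_trace hf hint x).norm (Eventually.of_forall fun r => ?_)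
  rw [setAverage_eq, norm_smul, norm_inv, Real.norm_of_nonneg measureReal_nonneg]
  have h1 := norm_setIntegral_le_of_norm_le_const_ae (volume_ball_inter_lt_top x r U)
    (ae_restrict_of_ae_restrict_of_subset inter_subset_right hC)
  -- Over a null set the average is 0 by the convention for the inverse, which is why `0 ≤ C` is
  -- assumed.
  rcases (measureReal_nonneg (μ := volume) (s := ball x r ∩ U)).eq_or_lt with h0 | h0
  · rw [← h0]
    simpa using hC0
  · rw [inv_mul_le_iff₀ h0, mul_comm]
    exact h1

/-- The trace of a constant is that constant on the closure of the domain. -/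
theorem trace_eq_const (hU : IsOpen U) {x : Plane} (hx : x ∈ closure U) {c : F}
    (hc : ∀ᵐ y ∂volume.restrict U, f y = c) : trace U f x = c := by
  refine Tendsto.limUnder_eq (tendsto_const_nhds.congr' ?_)
  filter_upwards [self_mem_nhdsWithin] with r hr
  have h1 : ⨍ y in ball x r ∩ U, f y = ⨍ _y in ball x r ∩ U, c :=
    average_congr (ae_restrict_of_ae_restrict_of_subset inter_subset_right hc)
  rw [h1, setAverage_const _ (volume_ball_inter_lt_top _ _ _).ne]
  exact ((isOpen_ball.inter hU).measure_pos _
    (_root_.mem_closure_iff.1 hx _ isOpen_ball (mem_ball_self hr))).ne'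

end Trace

/-! ### The outer normal -/

theorem IsOuterNormal.unique {U : Set Plane} {x ν ν' : Plane} (h : IsOuterNormal U x ν)
    (h' : IsOuterNormal U x ν') : ν = ν' := by
  obtain ⟨hν, r, hr, hU⟩ := h
  obtain ⟨hν', r', hr', hU'⟩ := h'
  by_contra hne
  have hlt : inner ℝ ν ν' < 1 := by
    exact (inner_lt_one_iff_real_of_norm_eq_one hν hν').2 hne
  have hn : 0 < ‖ν - ν'‖ := norm_pos_iff.2 (sub_ne_zero.2 hne)
  -- The point x + ε(ν − ν') lies in both balls, at distance half the smaller radius. Since ⟪ν, ν'⟫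
  -- < 1, the half-disc of ν' contains it and the half-disc of ν does not.
  set ε := min r r' / (2 * ‖ν - ν'‖) with hε
  have hε0 : 0 < ε := by have := lt_min hr hr'; positivity
  have hmem : ∀ R, min r r' ≤ R → x + ε • (ν - ν') ∈ ball x R := by
    intro R hR
    rw [mem_ball, dist_eq_norm, add_sub_cancel_left, norm_smul, Real.norm_of_nonneg hε0.le, hε]
    have := lt_min hr hr'
    field_simp
    linarith
  have h1 : x + ε • (ν - ν') ∈ U ∩ ball x r' := by
    rw [hU']
    refine ⟨hmem r' (min_le_right _ _), ?_⟩
    rw [add_sub_cancel_left, real_inner_smul_left, inner_sub_left,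
      real_inner_self_eq_norm_sq, hν']
    nlinarith
  have h2 : x + ε • (ν - ν') ∈ U ∩ ball x r := ⟨h1.1, hmem r (min_le_left _ _)⟩
  rw [hU] at h2
  have h3 := h2.2
  rw [add_sub_cancel_left, real_inner_smul_left, inner_sub_left,
    real_inner_self_eq_norm_sq, hν, real_inner_comm] at h3
  nlinarith

theorem outerNormal_eq {U : Set Plane} {x ν : Plane} (h : IsOuterNormal U x ν) :
    outerNormal U x = ν := by
  have hex : ∃ ν, IsOuterNormal U x ν := ⟨ν, h⟩
  rw [outerNormal, dif_pos hex]
  exact hex.choose_spec.unique h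

theorem norm_outerNormal_le (U : Set Plane) (x : Plane) : ‖outerNormal U x‖ ≤ 1 := by
  by_cases h : ∃ ν, IsOuterNormal U x ν
  · obtain ⟨ν, hν⟩ := h
    rw [outerNormal_eq hν, hν.1]
  · rw [outerNormal, dif_neg h, norm_zero]
    exact zero_le_one

theorem IsOuterNormal.mem_frontier {U : Set Plane} (hU : IsOpen U) {x ν : Plane}
    (h : IsOuterNormal U x ν) : x ∈ frontier U := by
  obtain ⟨hν, r, hr, hs⟩ := h
  rw [hU.frontier_eq]
  constructor
  · rw [Metric.mem_closure_iff]
    intro ε hε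
    have h0 := lt_min hr hε
    have hd : dist (x - (min r ε / 2) • ν) x = min r ε / 2 := by
      rw [dist_eq_norm, sub_sub_cancel_left, norm_neg, norm_smul, hν, mul_one,
        Real.norm_of_nonneg (by positivity)]
    have h1 : x - (min r ε / 2) • ν ∈ U ∩ ball x r := by
      rw [hs]
      constructor
      · rw [mem_ball, hd]
        have := min_le_left r ε
        linarith
      · rw [sub_sub_cancel_left, inner_neg_left, real_inner_smul_left,
          real_inner_self_eq_norm_sq, hν]
        linarith
    refine ⟨_, h1.1, ?_⟩
    rw [dist_comm, hd]
    have := min_le_right r ε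
    linarith
  · intro hx
    have h1 : x ∈ U ∩ ball x r := ⟨hx, mem_ball_self hr⟩
    rw [hs] at h1
    simpa using h1.2

/-- The outer normal is locally constant along the boundary. -/
theorem IsOuterNormal.eventually {U : Set Plane} (hU : IsOpen U) {x ν : Plane}
    (h : IsOuterNormal U x ν) : ∃ r > 0, ∀ y ∈ frontier U ∩ ball x r, IsOuterNormal U y ν := by
  obtain ⟨hν, r, hr, hs⟩ := h
  refine ⟨r, hr, ?_⟩
  rintro y ⟨hy, hyr⟩
  rw [hU.frontier_eq] at hy
  have hle : inner ℝ (y - x) ν ≤ 0 := by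
    have hcl : IsClosed {z : Plane | inner ℝ (z - x) ν ≤ 0} :=
      isClosed_le (by fun_prop) continuous_const
    have h1 : closure (U ∩ ball x r) ⊆ {z : Plane | inner ℝ (z - x) ν ≤ 0} := by
      refine closure_minimal ?_ hcl
      rw [hs]
      exact fun z hz => hz.2.le
    exact h1 (isOpen_ball.closure_inter ⟨hy.1, hyr⟩)
  have h0 : inner ℝ (y - x) ν = 0 := by
    refine hle.antisymm (not_lt.1 fun hlt => hy.2 ?_)
    have h1 : y ∈ U ∩ ball x r := by
      rw [hs]
      exact ⟨hyr, hlt⟩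
    exact h1.1
  refine ⟨hν, r - dist y x, by rw [mem_ball] at hyr; linarith, ?_⟩
  ext z
  have hz : inner ℝ (z - y) ν = inner ℝ (z - x) ν := by
    rw [← sub_sub_sub_cancel_right z y x, inner_sub_left, h0, sub_zero]
  have hball : z ∈ ball y (r - dist y x) → z ∈ ball x r := by
    intro h
    rw [mem_ball] at h ⊢
    linarith [dist_triangle z y x]
  simp only [mem_inter_iff, mem_ofPred_eq, hz]
  constructor
  · rintro ⟨h1, h2⟩
    have h3 : z ∈ U ∩ ball x r := ⟨h1, hball h2⟩
    rw [hs] at h3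
    exact ⟨h2, h3.2⟩
  · rintro ⟨h1, h2⟩
    have h3 : z ∈ U ∩ ball x r := by
      rw [hs]
      exact ⟨hball h1, h2⟩
    exact ⟨h3.1, h1⟩

/-- The points where a normal exists form a relatively open subset of the boundary, on which the
normal is locally constant; elsewhere `outerNormal` is 0. -/
theorem measurable_outerNormal {U : Set Plane} (hU : IsOpen U) : Measurable (outerNormal U) := by
  classical
  set N : Set Plane := {x | ∃ ν, IsOuterNormal U x ν} with hN
  have hloc : ∀ x ∈ N, ∃ r > 0, ∀ y ∈ frontier U ∩ ball x r,
      IsOuterNormal U y (outerNormal U x) := by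
    rintro x ⟨ν, hν⟩
    rw [outerNormal_eq hν]
    exact hν.eventually hU
  choose! r hr hloc using hloc
  have hNeq : N = frontier U ∩ ⋃ x ∈ N, ball x (r x) := by
    ext y
    simp only [mem_inter_iff, mem_iUnion, exists_prop]
    constructor
    · intro hy
      exact ⟨hy.choose_spec.mem_frontier hU, y, hy, mem_ball_self (hr y hy)⟩
    · rintro ⟨hy, x, hx, hyx⟩
      exact ⟨_, hloc x hx y ⟨hy, hyx⟩⟩
  have hmeas : MeasurableSet N := by
    rw [hNeq]
    exact isClosed_frontier.measurableSet.inter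
      (isOpen_biUnion fun _ _ => isOpen_ball).measurableSet
  have hcont : ContinuousOn (outerNormal U) N := by
    intro x hx
    refine continuousWithinAt_const.congr_of_eventuallyEq (f := fun _ => outerNormal U x) ?_ rfl
    filter_upwards [self_mem_nhdsWithin,
      mem_nhdsWithin_of_mem_nhds (ball_mem_nhds x (hr x hx))] with y hy hyx
    exact outerNormal_eq (hloc x hx y ⟨hy.choose_spec.mem_frontier hU, hyx⟩)
  have hpw : N.piecewise (outerNormal U) 0 = outerNormal U := by
    funext x
    by_cases hx : x ∈ N
    · rw [piecewise_eq_of_mem _ _ _ hx]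
    · rw [piecewise_eq_of_notMem _ _ _ hx]
      have hx' : ¬∃ ν, IsOuterNormal U x ν := hx
      rw [outerNormal, dif_neg hx']
      rfl
  rw [← hpw]
  exact hcont.measurable_piecewise continuousOn_const hmeas

/-! ### Weak derivatives of polynomials -/

theorem inner_gradient_left (φ : Plane → ℝ) (x v : Plane) :
    inner ℝ (gradient φ x) v = fderiv ℝ φ x v := by
  rw [gradient, InnerProductSpace.toDual_symm_apply]

theorem IsTest.mono {K U : Set Plane} {φ : Plane → ℝ} (h : IsTest K φ) (hKU : K ⊆ U) :
    IsTest U φ := ⟨h.1, h.2.1, h.2.2.trans hKU⟩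

theorem IsTest.continuous_gradient {U : Set Plane} {φ : Plane → ℝ} (h : IsTest U φ) :
    Continuous (gradient φ) :=
  (InnerProductSpace.toDual ℝ Plane).symm.continuous.comp (h.1.continuous_fderiv (by simp))

theorem IsTest.hasCompactSupport_gradient {U : Set Plane} {φ : Plane → ℝ} (h : IsTest U φ) :
    HasCompactSupport (gradient φ) :=
  (h.2.1.fderiv ℝ).comp_left (g := (InnerProductSpace.toDual ℝ Plane).symm) (map_zero _)

theorem IsTest.eq_zero {U : Set Plane} {φ : Plane → ℝ} (h : IsTest U φ) {x : Plane}
    (hx : x ∉ U) : φ x = 0 := image_eq_zero_of_notMem_tsupport fun h' => hx (h.2.2 h')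

theorem IsTest.gradient_eq_zero {U : Set Plane} {φ : Plane → ℝ} (h : IsTest U φ) {x : Plane}
    (hx : x ∉ U) : gradient φ x = 0 := by
  have h1 : fderiv ℝ φ x = 0 := by
    by_contra hne
    exact hx (h.2.2 (support_fderiv_subset ℝ (f := φ) hne))
  rw [gradient, h1, map_zero]

/-- Integration by parts against an affine function. -/
theorem IsTest.integral_affine_mul_fderiv {U : Set Plane} {φ : Plane → ℝ} (h : IsTest U φ)
    (c : ℝ) (b e : Plane) :
    ∫ x, (c + inner ℝ b x) * fderiv ℝ φ x e = -(inner ℝ b e * ∫ x, φ x) := by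
  have hd : ∀ x, HasFDerivAt (fun x : Plane => c + inner ℝ b x) (innerSL ℝ b) x := fun x =>
    ((innerSL ℝ b).hasFDerivAt (x := x)).const_add c
  have hfd : Continuous fun x => fderiv ℝ φ x e :=
    (h.1.continuous_fderiv (by simp)).clm_apply continuous_const
  have hsupp : HasCompactSupport fun x => fderiv ℝ φ x e := h.2.1.fderiv_apply ℝ e
  rw [integral_mul_fderiv_eq_neg_fderiv_mul_of_integrable]
  · simp only [fun x => (hd x).fderiv, innerSL_apply_apply]
    rw [integral_const_mul]
  · simp only [fun x => (hd x).fderiv]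
    exact (h.1.continuous.integrable_of_hasCompactSupport h.2.1).const_mul _
  · exact (Continuous.mul (by fun_prop) hfd).integrable_of_hasCompactSupport hsupp.mul_left
  · exact (Continuous.mul (by fun_prop) h.1.continuous).integrable_of_hasCompactSupport
      h.2.1.mul_left
  · exact fun x _ => (hd x).differentiableAt
  · exact fun x _ => (h.1.differentiable (by simp)).differentiableAt

theorem setIntegral_eq_integral_of_ae_eq {F : Type*} [NormedAddCommGroup F] [NormedSpace ℝ F]
    {K U : Set Plane} (hU : MeasurableSet U) (hKU : K ⊆ U) {f g : Plane → F}
    (hf : ∀ x ∉ K, f x = 0) (hg : ∀ x ∉ K, g x = 0)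
    (hfg : ∀ᵐ x ∂volume.restrict K, f x = g x) : ∫ x in U, f x = ∫ x, g x := by
  rw [← setIntegral_eq_integral_of_forall_compl_eq_zero (s := K) hg,
    setIntegral_eq_of_subset_of_forall_sdiff_eq_zero hU hKU fun x hx => hf x hx.2]
  exact integral_congr_ae hfg

/-- The fundamental lemma of the calculus of variations on `K`, applied to f − c. -/
theorem ae_eq_const_of_integral_test {F : Type*} [NormedAddCommGroup F] [NormedSpace ℝ F]
    [CompleteSpace F] {K U : Set Plane} (hK : IsOpen K) (hKU : K ⊆ U)
    (f : Lp F 2 (volume.restrict U)) (c : F)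
    (h : ∀ φ, IsTest K φ → ∫ x in U, φ x • f x = (∫ x, φ x) • c) :
    ∀ᵐ x ∂volume.restrict K, f x = c := by
  have hf : LocallyIntegrable f (volume.restrict U) :=
    (Lp.memLp f).locallyIntegrable (by norm_num)
  have hc : LocallyIntegrable (fun _ : Plane => c) (volume.restrict U) :=
    locallyIntegrable_const c
  have key := hK.ae_eq_zero_of_integral_contDiff_smul_eq_zero
    ((hf.sub hc).locallyIntegrableOn K) (fun φ h1 h2 h3 => ?_)
  · rw [← Measure.restrict_restrict_of_subset hKU, ae_restrict_iff' hK.measurableSet]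
    filter_upwards [key] with x hx hxK
    exact sub_eq_zero.1 (hx hxK)
  · have ht : IsTest K φ := ⟨h1, h2, h3⟩
    have i1 : Integrable (fun x => φ x • f x) (volume.restrict U) :=
      memLp_one_iff_integrable.1 ((Lp.memLp f).smul (ht.memLp 2 U))
    have i2 : Integrable (fun x => φ x • c) (volume.restrict U) :=
      ((h1.continuous.integrable_of_hasCompactSupport h2).restrict).smul_const c
    simp only [Pi.sub_apply, smul_sub]
    rw [integral_sub i1 i2, h φ ht, integral_smul_const,
      setIntegral_eq_integral_of_forall_compl_eq_zero fun x hx => ht.eq_zero fun h' => hx (hKU h'),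
      sub_self]

/-- A weak gradient of a function that is affine on an open set is constant there. -/
theorem IsWeakGrad.isConstOn {K U : Set Plane} (hK : IsOpen K) (hU : IsOpen U) (hKU : K ⊆ U)
    {q : L2 U} {g : L2v U} (h : IsWeakGrad U q g) (hq : IsAffineOn K q) : IsConstOn K g := by
  obtain ⟨c, b, hq⟩ := hq
  refine ⟨b, ae_eq_const_of_integral_test hK hKU g b fun φ hφ => ?_⟩
  have hφU := hφ.mono hKU
  -- The vector identity is tested against each direction e, which reduces it to the scalar
  -- integration by parts.
  refine ext_inner_right ℝ fun e => ?_
  have h1 : ∫ x in U, φ x • g x = -∫ x in U, q x • gradient φ x := by rw [h φ hφU, neg_neg]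
  have h2 : ∫ x in U, q x • gradient φ x = ∫ x, (c + inner ℝ b x) • gradient φ x := by
    refine setIntegral_eq_integral_of_ae_eq hU.measurableSet hKU
      (fun x hx => by rw [hφ.gradient_eq_zero hx, smul_zero])
      (fun x hx => by rw [hφ.gradient_eq_zero hx, smul_zero]) ?_
    filter_upwards [hq] with x hx
    rw [hx]
  have hcont : Continuous fun x => (c + inner ℝ b x) • gradient φ x := by
    have h0 : Continuous fun x : Plane => c + inner ℝ b x := by fun_prop
    exact h0.smul hφ.continuous_gradient
  have hint : Integrable fun x => (c + inner ℝ b x) • gradient φ x := by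
    refine hcont.integrable_of_hasCompactSupport ?_
    exact HasCompactSupport.smul_left (f := fun x => c + inner ℝ b x)
      hφ.hasCompactSupport_gradient
  rw [h1, h2, inner_neg_left, real_inner_comm, ← integral_inner hint, real_inner_smul_left]
  have h3 := hφ.integral_affine_mul_fderiv c b e
  have h4 : ∀ x, inner ℝ e ((c + inner ℝ b x) • gradient φ x) =
      (c + inner ℝ b x) * fderiv ℝ φ x e := fun x => by
    rw [real_inner_smul_right, real_inner_comm (gradient φ x) e, inner_gradient_left]
  simp only [h4, h3]
  ring

/-- A weak divergence of a field that is a Raviart-Thomas polynomial on an open set is constant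
there. -/
theorem IsWeakDiv.isConstOn {K U : Set Plane} (hK : IsOpen K) (hU : IsOpen U) (hKU : K ⊆ U)
    {v : L2v U} {d : L2 U} (h : IsWeakDiv U v d) (hv : IsRTOn K v) : IsConstOn K d := by
  obtain ⟨c, s, hv⟩ := hv
  -- In the plane the divergence of c + s x is 2s.
  refine ⟨2 * s, ae_eq_const_of_integral_test hK hKU d (2 * s) fun φ hφ => ?_⟩
  have hφU := hφ.mono hKU
  have h1 : ∫ x in U, φ x • d x = -∫ x in U, inner ℝ (v x) (gradient φ x) := by
    rw [h φ hφU, neg_neg]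
    simp only [smul_eq_mul, mul_comm]
  have h2 : ∫ x in U, inner ℝ (v x) (gradient φ x) =
      ∫ x, inner ℝ (c + s • x) (gradient φ x) := by
    refine setIntegral_eq_integral_of_ae_eq hU.measurableSet hKU
      (fun x hx => by rw [hφ.gradient_eq_zero hx, inner_zero_right])
      (fun x hx => by rw [hφ.gradient_eq_zero hx, inner_zero_right]) ?_
    filter_upwards [hv] with x hx
    rw [hx]
  set e : Fin 2 → Plane := fun i => EuclideanSpace.single i 1 with he
  -- Each coordinate of a Raviart-Thomas polynomial is affine, so the scalar formula applies twice.
  have h3 : ∀ x, inner ℝ (c + s • x) (gradient φ x) =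
      ∑ i, (c i + inner ℝ (s • e i) x) * fderiv ℝ φ x (e i) := by
    intro x
    simp only [← inner_gradient_left, he, Fin.sum_univ_two, PiLp.inner_apply]
    simp [mul_comm]
  have hint : ∀ i, Integrable fun x => (c i + inner ℝ (s • e i) x) * fderiv ℝ φ x (e i) := by
    intro i
    have hfd : Continuous fun x => fderiv ℝ φ x (e i) :=
      (hφ.1.continuous_fderiv (by simp)).clm_apply continuous_const
    exact (Continuous.mul (by fun_prop) hfd).integrable_of_hasCompactSupport
      (HasCompactSupport.mul_left (hφ.2.1.fderiv_apply ℝ (e i)))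
  have h4 : ∀ i, inner ℝ (s • e i) (e i) = s := by
    intro i
    simp [he, real_inner_smul_left]
  rw [h1, h2]
  simp only [h3]
  rw [integral_finsetSum _ fun i _ => hint i]
  simp only [hφ.integral_affine_mul_fderiv, h4, Fin.sum_univ_two, smul_eq_mul]
  ring

/-! ### Mollification -/

/-- The smooth bump of outer radius `η` (for `η > 0`). -/
def bump (η : ℝ) : ContDiffBump (0 : Plane) :=
  if h : 0 < η then ⟨η / 2, η, by positivity, by linarith⟩ else default

/-- The mollification of `q` at scale `η`. -/
def mollify (η : ℝ) (q : Plane → ℝ) (y : Plane) : ℝ :=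
  ∫ t, q t * (bump η).normed volume (y - t)

theorem bump_rOut {η : ℝ} (h : 0 < η) : (bump η).rOut = η := by rw [bump, dif_pos h]

theorem bump_rIn {η : ℝ} (h : 0 < η) : (bump η).rIn = η / 2 := by rw [bump, dif_pos h]

theorem bump_normed_eq_zero {η : ℝ} (h : 0 < η) {y t : Plane} (ht : t ∉ ball y η) :
    (bump η).normed volume (y - t) = 0 := by
  have h1 : y - t ∉ Function.support ((bump η).normed (volume : Measure Plane)) := by
    rw [ContDiffBump.support_normed_eq, bump_rOut h]
    rwa [mem_ball_zero_iff, ← dist_eq_norm, dist_comm]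
  simpa using h1

/-- The bump is at most 1 and equals 1 on the disc of radius η/2, whose area is πη²/4. -/
theorem bump_normed_le {η : ℝ} (h : 0 < η) (x : Plane) :
    (bump η).normed volume x ≤ 4 / (Real.pi * η ^ 2) := by
  refine ((bump η).normed_le_div_measure_closedBall_rIn volume x).trans_eq ?_
  rw [bump_rIn h, measureReal_def, Measure.addHaar_closedBall_eq_addHaar_ball,
    EuclideanSpace.volume_ball_fin_two, ENNReal.toReal_mul, ENNReal.toReal_pow,
    ENNReal.toReal_ofReal (by positivity), ENNReal.toReal_ofReal Real.pi_pos.le]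
  have := Real.pi_pos
  field_simp
  norm_num

theorem mollify_eq_of_ae_eq {η : ℝ} (h : 0 < η) {q : Plane → ℝ} {y : Plane} {c : ℝ}
    (hc : ∀ᵐ t ∂volume.restrict (ball y η), q t = c) : mollify η q y = c := by
  have h1 : mollify η q y = ∫ t, c * (bump η).normed volume (y - t) := by
    refine integral_congr_ae ?_
    rw [ae_restrict_iff' measurableSet_ball] at hc
    filter_upwards [hc] with t ht
    by_cases hy : t ∈ ball y η
    · rw [ht hy]
    · rw [bump_normed_eq_zero h hy, mul_zero, mul_zero]
  rw [h1, integral_const_mul, integral_sub_left_eq_self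
    (fun t => (bump η).normed volume t) volume y, (bump η).integral_normed, mul_one]

theorem mollify_eq_convolution (η : ℝ) (q : Plane → ℝ) :
    mollify η q = q ⋆[ContinuousLinearMap.lsmul ℝ ℝ, volume] (bump η).normed volume := rfl

/-- Mollifications converge almost everywhere. -/
theorem ae_tendsto_mollify {q : Plane → ℝ} (hq : LocallyIntegrable q) :
    ∀ᵐ y, Tendsto (fun η => mollify η q y) (𝓝[>] 0) (𝓝 (q y)) := by
  have h := ContDiffBump.ae_convolution_tendsto_right_of_locallyIntegrable
    (φ := bump) (l := 𝓝[>] (0 : ℝ)) (K := 2) (μ := (volume : Measure Plane)) ?_ ?_ hq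
  · filter_upwards [h] with y hy
    refine hy.congr fun η => ?_
    rw [mollify_eq_convolution, ← convolution_flip]
    simp only [convolution_def]
    refine integral_congr_ae (Eventually.of_forall fun t => ?_)
    simp [mul_comm]
  · have h1 : Tendsto (fun η : ℝ => η) (𝓝[>] 0) (𝓝 0) :=
      tendsto_nhdsWithin_of_tendsto_nhds tendsto_id
    refine h1.congr' ?_
    filter_upwards [self_mem_nhdsWithin] with η hη
    rw [bump_rOut hη]
  · filter_upwards [self_mem_nhdsWithin] with η hη
    rw [bump_rOut hη, bump_rIn hη]
    linarith

/-- Cauchy-Schwarz against the constant 1. With A = ∫_B f, expanding ∫_B (|B| f − A)² ≥ 0 gives |B|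
times the claim, so |B| = 0 is treated separately. -/
theorem sq_setIntegral_le {α : Type*} [MeasurableSpace α] {μ : Measure α} {B : Set α}
    (hB : μ B ≠ ⊤) {f : α → ℝ} (hf : MemLp f 2 (μ.restrict B)) :
    (∫ x in B, f x ∂μ) ^ 2 ≤ μ.real B * ∫ x in B, f x ^ 2 ∂μ := by
  have : IsFiniteMeasure (μ.restrict B) := ⟨by rw [Measure.restrict_apply_univ]; exact hB.lt_top⟩
  have hf1 : Integrable f (μ.restrict B) := hf.integrable (by norm_num)
  have hf2 : Integrable (fun x => f x ^ 2) (μ.restrict B) := hf.integrable_sq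
  set A := ∫ x in B, f x ∂μ with hA
  have h0 : 0 ≤ ∫ x in B, (μ.real B * f x - A) ^ 2 ∂μ := integral_nonneg fun x => sq_nonneg _
  have h1 : ∫ x in B, (μ.real B * f x - A) ^ 2 ∂μ =
      μ.real B * (μ.real B * ∫ x in B, f x ^ 2 ∂μ - A ^ 2) := by
    have e : ∀ x, (μ.real B * f x - A) ^ 2 =
        μ.real B ^ 2 * f x ^ 2 - (2 * μ.real B * A) * f x + A ^ 2 := fun x => by ring
    simp only [e]
    have i1 : Integrable (fun x => μ.real B ^ 2 * f x ^ 2 - 2 * μ.real B * A * f x)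
        (μ.restrict B) := (hf2.const_mul _).sub (hf1.const_mul _)
    rw [integral_add i1 (integrable_const _),
      integral_sub (hf2.const_mul _) (hf1.const_mul _), integral_const_mul, integral_const_mul,
      ← hA, setIntegral_const, smul_eq_mul]
    ring
  rw [h1] at h0
  rcases (measureReal_nonneg (μ := μ) (s := B)).eq_or_lt with hz | hpos
  · have hz' : μ B = 0 := by
      rw [measureReal_def, eq_comm, ENNReal.toReal_eq_zero_iff] at hz
      exact hz.resolve_right hB
    rw [hA, Measure.restrict_eq_zero.2 hz', integral_zero_measure, ← hz]
    simp
  · have := nonneg_of_mul_nonneg_right h0 hpos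
    linarith

section Mollify

variable {U : Set Plane} {q : L2 U} {g : L2v U}

theorem locallyIntegrable_indicator (hU : IsOpen U) (q : L2 U) :
    LocallyIntegrable (U.indicator q) := by
  have h1 : MemLp (U.indicator q) 2 volume :=
    (memLp_indicator_iff_restrict hU.measurableSet).2 (Lp.memLp q)
  exact h1.locallyIntegrable (by norm_num)

/-- The derivative of a mollification is controlled by the weak gradient. -/
theorem hasFDerivAt_mollify (hU : IsOpen U) (h : IsWeakGrad U q g) {η : ℝ} (hη : 0 < η)
    {y : Plane} {W : Set Plane} (hWU : W ⊆ U) (hy : closedBall y η ⊆ W) :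
    ∃ L : Plane →L[ℝ] ℝ, HasFDerivAt (mollify η (U.indicator q)) L y ∧
      ‖L‖ ≤ 4 / η * Real.sqrt (∫ t in W, ‖g t‖ ^ 2) := by
  set ρ := (bump η).normed (volume : Measure Plane) with hρ
  have hρs : HasCompactSupport ρ := (bump η).hasCompactSupport_normed
  have hρd : ContDiff ℝ ∞ ρ := (bump η).contDiff_normed
  have hQ := locallyIntegrable_indicator hU q
  refine ⟨_, hρs.hasFDerivAt_convolution_right (ContinuousLinearMap.lsmul ℝ ℝ) hQ
    (hρd.of_le (by exact_mod_cast le_top)) y, ?_⟩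
  refine ContinuousLinearMap.opNorm_le_bound _ (by positivity) fun e => ?_
  rw [convolution_precompR_apply _ hQ (hρs.fderiv ℝ) (hρd.continuous_fderiv (by simp))]
  -- The derivative falls on the kernel. As a function of t the kernel is a test function on U, so
  -- the weak gradient identity turns the derivative of the mollification into a mollification of g.
  set φ : Plane → ℝ := fun t => ρ (y - t) with hφ
  have hball : closedBall y η ⊆ U := hy.trans hWU
  have htest : IsTest U φ := by
    have hsub : tsupport φ ⊆ closedBall y η := by
      refine closure_minimal (fun t ht => ?_) isClosed_closedBall
      by_contra hne
      exact ht (bump_normed_eq_zero hη fun hb => hne (ball_subset_closedBall hb))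
    exact ⟨hρd.comp (contDiff_const.sub contDiff_id),
      (isCompact_closedBall y η).of_isClosed_subset (isClosed_tsupport φ) hsub, hsub.trans hball⟩
  have hfd : ∀ t, fderiv ℝ φ t e = -fderiv ℝ ρ (y - t) e := by
    intro t
    have h1 : HasFDerivAt ρ (fderiv ℝ ρ (y - t)) (y - t) :=
      (hρd.differentiable (by simp)).differentiableAt.hasFDerivAt
    have h2 : HasFDerivAt φ _ t := h1.comp t ((hasFDerivAt_id t).const_sub y)
    rw [h2.fderiv]
    simp
  have h1 : ((U.indicator q) ⋆[ContinuousLinearMap.lsmul ℝ ℝ, volume]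
      fun x => fderiv ℝ ρ x e) y = ∫ t in U, φ t * inner ℝ (g t) e := by
    have i1 : Integrable (fun t => q t • gradient φ t) (volume.restrict U) :=
      memLp_one_iff_integrable.1 ((htest.memLp_gradient 2 U).smul (Lp.memLp q))
    have i2 : Integrable (fun t => φ t • g t) (volume.restrict U) :=
      memLp_one_iff_integrable.1 ((Lp.memLp g).smul (htest.memLp 2 U))
    have h2 := congrArg (inner ℝ e) (h φ htest)
    rw [inner_neg_right, ← integral_inner i1, ← integral_inner i2] at h2
    have e1 : ∀ t, inner ℝ e (q t • gradient φ t) = -(q t * fderiv ℝ ρ (y - t) e) := fun t => by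
      rw [real_inner_smul_right, real_inner_comm (gradient φ t) e, inner_gradient_left, hfd]
      ring
    have e2 : ∀ t, inner ℝ e (φ t • g t) = φ t * inner ℝ (g t) e := fun t => by
      rw [real_inner_smul_right, real_inner_comm (g t) e]
    simp only [e1, e2] at h2
    rw [integral_neg, neg_inj] at h2
    rw [← h2, convolution_def, ← integral_indicator hU.measurableSet]
    refine integral_congr_ae (Eventually.of_forall fun t => ?_)
    by_cases ht : t ∈ U <;> simp [ht]
  rw [h1]
  set B := ball y η with hB
  have hBU : B ⊆ U := ball_subset_closedBall.trans hball
  have hBfin : volume B ≠ ⊤ := measure_ball_lt_top.ne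
  have : IsFiniteMeasure (volume.restrict B) :=
    ⟨by rw [Measure.restrict_apply_univ]; exact hBfin.lt_top⟩
  have hgU : MemLp (fun t => ‖g t‖) 2 (volume.restrict U) := (Lp.memLp g).norm
  have hgB : MemLp (fun t => ‖g t‖) 2 (volume.restrict B) :=
    hgU.mono_measure (Measure.restrict_mono hBU le_rfl)
  have hpi := Real.pi_pos
  have h3 : ‖∫ t in U, φ t * inner ℝ (g t) e‖ ≤
      4 / (Real.pi * η ^ 2) * ‖e‖ * ∫ t in B, ‖g t‖ := by
    rw [setIntegral_eq_of_subset_of_forall_sdiff_eq_zero hU.measurableSet hBU fun t ht => by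
      rw [hφ]
      simp only
      rw [hρ, bump_normed_eq_zero hη ht.2, zero_mul], ← integral_const_mul]
    refine norm_integral_le_of_norm_le ((hgB.integrable (by norm_num)).const_mul _)
      (Eventually.of_forall fun t => ?_)
    rw [norm_mul, Real.norm_of_nonneg ((bump η).nonneg_normed _)]
    calc ρ (y - t) * ‖inner ℝ (g t) e‖ ≤ 4 / (Real.pi * η ^ 2) * (‖g t‖ * ‖e‖) := by
          gcongr
          · exact bump_normed_le hη _
          · exact norm_inner_le_norm _ _
      _ = _ := by ring
  set E := ∫ t in W, ‖g t‖ ^ 2 with hE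
  have hE0 : 0 ≤ E := integral_nonneg fun t => by positivity
  -- Cauchy-Schwarz gives the factor √π η. It is enlarged to π η so that π cancels against the bound
  -- of the kernel, leaving 4/η.
  have h4 : ∫ t in B, ‖g t‖ ≤ Real.pi * η * Real.sqrt E := by
    have h5 := sq_setIntegral_le hBfin hgB
    have h6 : ∫ t in B, ‖g t‖ ^ 2 ≤ E := by
      refine setIntegral_mono_set ?_ (Eventually.of_forall fun t => by positivity)
        (LE.le.eventuallyLE (ball_subset_closedBall.trans hy))
      exact hgU.integrable_sq.mono_measure (Measure.restrict_mono hWU le_rfl)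
    have h7 : volume.real B = Real.pi * η ^ 2 := by
      rw [measureReal_def, hB, EuclideanSpace.volume_ball_fin_two, ENNReal.toReal_mul,
        ENNReal.toReal_pow, ENNReal.toReal_ofReal hη.le, ENNReal.toReal_ofReal hpi.le, mul_comm]
    refine abs_le_of_sq_le_sq' ?_ (by positivity) |>.2
    rw [mul_pow, mul_pow, Real.sq_sqrt hE0]
    calc (∫ t in B, ‖g t‖) ^ 2 ≤ Real.pi * η ^ 2 * E := by
          refine h5.trans ?_
          rw [h7]
          gcongr
      _ ≤ Real.pi ^ 2 * η ^ 2 * E := by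
          have : Real.pi ≤ Real.pi ^ 2 := by nlinarith [Real.pi_gt_three]
          gcongr
  refine h3.trans ?_
  calc 4 / (Real.pi * η ^ 2) * ‖e‖ * ∫ t in B, ‖g t‖
      ≤ 4 / (Real.pi * η ^ 2) * ‖e‖ * (Real.pi * η * Real.sqrt E) := by gcongr
    _ = 4 / η * Real.sqrt E * ‖e‖ := by field_simp

/-- The mean value inequality on the convex set `S`. `W` localises the energy, so that it can later
be a shrinking neighbourhood. -/
theorem abs_mollify_sub_le (hU : IsOpen U) (h : IsWeakGrad U q g) {η : ℝ} (hη : 0 < η)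
    {S W : Set Plane} (hWU : W ⊆ U) (hS : Convex ℝ S) (hSW : ∀ y ∈ S, closedBall y η ⊆ W)
    {y z : Plane} (hy : y ∈ S) (hz : z ∈ S) :
    ‖mollify η (U.indicator q) y - mollify η (U.indicator q) z‖ ≤
      4 / η * Real.sqrt (∫ t in W, ‖g t‖ ^ 2) * ‖y - z‖ := by
  choose! L hL hLn using fun y (hy : y ∈ S) => hasFDerivAt_mollify hU h hη hWU (hSW y hy)
  exact hS.norm_image_sub_le_of_norm_hasFDerivWithin_le
    (fun y hy => (hL y hy).hasFDerivWithinAt) hLn hz hy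

/-- If `S` is connected and `U` contains the images of `S` under contraction to `p`, then the
mollifications at two points of `S`, contracted to `p` at scales along which the Dirichlet energy
tends to zero, have the same limiting behaviour. -/
theorem eventually_tendsto_mollify_sub (hU : IsOpen U) (h : IsWeakGrad U q g) {p : Plane}
    {S : Set Plane} (hSo : IsOpen S) (hSc : IsPreconnected S)
    {l : Filter ℝ} (hl : ∀ᶠ c in l, 0 < c ∧ ∀ y ∈ S, p + c • (y - p) ∈ U)
    (hE : ∀ R : ℝ, 0 < R → Tendsto (fun c => ∫ t in U ∩ ball p (c * R), ‖g t‖ ^ 2) l (𝓝 0))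
    {y z : Plane} (hy : y ∈ S) (hz : z ∈ S) :
    ∀ᶠ ε in 𝓝[>] (0 : ℝ), Tendsto (fun c => mollify (c * ε) (U.indicator q) (p + c • (y - p)) -
      mollify (c * ε) (U.indicator q) (p + c • (z - p))) l (𝓝 0) := by
  -- The relation is transitive, so on a connected set it is enough to have it locally, in both
  -- orders.
  refine hSc.induction₂' (fun y z => ∀ᶠ ε in 𝓝[>] (0 : ℝ),
    Tendsto (fun c => mollify (c * ε) (U.indicator q) (p + c • (y - p)) -
      mollify (c * ε) (U.indicator q) (p + c • (z - p))) l (𝓝 0)) ?_ ?_ hy hz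
  · intro z hz
    obtain ⟨δ, hδ, hδS⟩ := Metric.isOpen_iff.1 hSo z hz
    have key : ∀ y ∈ ball z (δ / 2), ∀ w ∈ ball z (δ / 2), ∀ᶠ ε in 𝓝[>] (0 : ℝ),
        Tendsto (fun c => mollify (c * ε) (U.indicator q) (p + c • (y - p)) -
          mollify (c * ε) (U.indicator q) (p + c • (w - p))) l (𝓝 0) := by
      intro y hy w hw
      filter_upwards [Ioo_mem_nhdsGT (half_pos hδ)] with ε hε
      have hε0 : 0 < ε := hε.1
      have hR : 0 < ‖z - p‖ + δ := by positivity
      -- Scale invariance: the derivative bound 4/(cε) multiplies a distance c‖y − w‖, so c cancels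
      -- and only the vanishing energy is left. The radius ‖z − p‖ + δ, scaled by c, covers every
      -- disc used in the mollification.
      have hlim : Tendsto (fun c => 4 / ε *
          Real.sqrt (∫ t in U ∩ ball p (c * (‖z - p‖ + δ)), ‖g t‖ ^ 2) * ‖y - w‖) l (𝓝 0) := by
        have h1 := (((Real.continuous_sqrt.tendsto 0).comp (hE _ hR)).const_mul (4 / ε)).mul_const
          ‖y - w‖
        simpa using h1
      refine squeeze_zero_norm' ?_ hlim
      filter_upwards [hl] with c hc
      obtain ⟨hc0, hSU⟩ := hc
      have hmem : ∀ x ∈ ball z (δ / 2), p + c • (x - p) ∈ ball (p + c • (z - p)) (c * (δ / 2)) := by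
        intro x hx
        rw [mem_ball, dist_eq_norm] at hx ⊢
        rw [add_sub_add_left_eq_sub, ← smul_sub, sub_sub_sub_cancel_right, norm_smul,
          Real.norm_of_nonneg hc0.le]
        gcongr
      have hsub : ∀ x ∈ ball (p + c • (z - p)) (c * (δ / 2)),
          closedBall x (c * ε) ⊆ U ∩ ball p (c * (‖z - p‖ + δ)) := by
        intro x hx t ht
        rw [mem_ball, dist_eq_norm] at hx
        rw [mem_closedBall, dist_eq_norm] at ht
        have h1 : ‖t - (p + c • (z - p))‖ < c * δ := by
          have h2 := norm_add_le (t - x) (x - (p + c • (z - p)))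
          rw [sub_add_sub_cancel] at h2
          have h3 : c * ε < c * (δ / 2) := by gcongr; exact hε.2
          linarith
        -- Undoing the contraction carries t into the ball of radius δ about z, hence into `S`,
        -- whose contraction lies in `U`.
        have ht' : t = p + c • ((p + c⁻¹ • (t - p)) - p) := by
          rw [add_sub_cancel_left, smul_smul, mul_inv_cancel₀ hc0.ne', one_smul,
            add_sub_cancel]
        constructor
        · rw [ht']
          refine hSU _ (hδS ?_)
          rw [mem_ball, dist_eq_norm]
          have h4 : p + c⁻¹ • (t - p) - z = c⁻¹ • (t - (p + c • (z - p))) := by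
            rw [← sub_sub, smul_sub c⁻¹ (t - p), smul_smul, inv_mul_cancel₀ hc0.ne', one_smul]
            abel
          rw [h4, norm_smul, norm_inv, Real.norm_of_nonneg hc0.le, inv_mul_lt_iff₀ hc0]
          exact h1
        · rw [mem_ball, dist_eq_norm]
          have h5 := norm_add_le (t - (p + c • (z - p))) (c • (z - p))
          rw [norm_smul, Real.norm_of_nonneg hc0.le] at h5
          have h6 : t - (p + c • (z - p)) + c • (z - p) = t - p := by abel
          rw [h6] at h5
          rw [mul_add]
          linarith
      refine (abs_mollify_sub_le hU h (mul_pos hc0 hε0) inter_subset_left (convex_ball _ _) hsub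
        (hmem y hy) (hmem w hw)).trans_eq ?_
      rw [add_sub_add_left_eq_sub, ← smul_sub, sub_sub_sub_cancel_right, norm_smul,
          Real.norm_of_nonneg hc0.le]
      field_simp
    have hz2 : z ∈ ball z (δ / 2) := mem_ball_self (half_pos hδ)
    filter_upwards [mem_nhdsWithin_of_mem_nhds (ball_mem_nhds z (half_pos hδ))] with y hy
    exact ⟨key z hz2 y hy, key y hy z hz2⟩
  · intro x y z _ _ _ hxy hyz
    filter_upwards [hxy, hyz] with ε h1 h2
    simpa using h1.add h2

/-- A function with zero weak gradient on a connected open set is constant. -/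
theorem IsWeakGrad.exists_ae_eq_const (hU : IsOpen U) (hq : IsWeakGrad U q g)
    {V : Set Plane} (hVU : V ⊆ U) (hV : IsOpen V) (hVc : IsPreconnected V) (hg : g = 0) :
    ∃ c : ℝ, ∀ᵐ x ∂volume.restrict V, q x = c := by
  -- With the filter `pure 1` and p = 0 there is no contraction, and the energy vanishes because g
  -- does. The contraction lemma then gives equal mollified values at any two points of `V`.
  have hE : ∀ R : ℝ, 0 < R → Tendsto (fun c => ∫ t in U ∩ ball (0 : Plane) (c * R), ‖g t‖ ^ 2)
      (pure 1) (𝓝 0) := by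
    intro R _
    refine tendsto_const_nhds.congr fun c => ?_
    rw [eq_comm]
    refine integral_eq_zero_of_ae (ae_restrict_of_ae_restrict_of_subset inter_subset_left ?_)
    rw [hg]
    filter_upwards [Lp.coeFn_zero Plane 2 (volume.restrict U)] with x hx
    rw [hx]
    simp
  have key : ∀ y ∈ V, ∀ z ∈ V, ∀ᶠ ε in 𝓝[>] (0 : ℝ),
      mollify ε (U.indicator q) y = mollify ε (U.indicator q) z := by
    intro y hy z hz
    filter_upwards [eventually_tendsto_mollify_sub hU hq (p := 0) hV hVc
      (l := pure 1) (by simpa using fun y hy => hVU hy) hE hy hz] with ε hε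
    have h2 := tendsto_nhds_unique hε (tendsto_pure_nhds _ _)
    simp only [one_mul, one_smul, sub_zero, zero_add] at h2
    linarith
  have hae : ∀ᵐ x ∂volume.restrict V, Tendsto (fun η => mollify η (U.indicator q) x) (𝓝[>] 0)
      (𝓝 (q x)) := by
    filter_upwards [ae_restrict_of_ae (ae_tendsto_mollify (locallyIntegrable_indicator hU q)),
      ae_restrict_mem hV.measurableSet] with x hx hxV
    rwa [indicator_of_mem (hVU hxV)] at hx
  rcases V.eq_empty_or_nonempty with rfl | hne
  · exact ⟨0, by simp⟩
  have : (ae (volume.restrict V)).NeBot := by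
    rw [ae_neBot, Ne, Measure.restrict_eq_zero]
    exact (hV.measure_pos _ hne).ne'
  -- One point where the mollifications converge serves as reference; its limit is the constant.
  obtain ⟨z, hz, hzV⟩ := (hae.and (ae_restrict_mem hV.measurableSet)).exists
  refine ⟨q z, ?_⟩
  filter_upwards [hae, ae_restrict_mem hV.measurableSet] with x hx hxV
  exact tendsto_nhds_unique (hx.congr' (key x hxV z hzV)) hz

end Mollify

/-! ### Touching polygons -/

/-- Near a point of its closure, a polygon is connected and a cone. -/
theorem IsPolygon.exists_cone {U : Set Plane} (hU : IsPolygon U) {p : Plane} (hp : p ∈ closure U) :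
    ∃ R > 0, IsPreconnected (U ∩ ball p R) ∧
      ∀ c : ℝ, 0 < c → c ≤ 1 → ∀ y ∈ U ∩ ball p R, p + c • (y - p) ∈ U := by
  by_cases hpU : p ∈ U
  · obtain ⟨R, hR, hRU⟩ := Metric.isOpen_iff.1 hU.isOpen p hpU
    refine ⟨R, hR, ?_, ?_⟩
    · rw [inter_eq_self_of_subset_right hRU]
      exact (convex_ball p R).isPreconnected
    · rintro c hc0 hc1 y ⟨-, hy⟩
      refine hRU ?_
      rw [mem_ball, dist_eq_norm] at hy ⊢
      rw [add_sub_cancel_left, norm_smul, Real.norm_of_nonneg hc0.le]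
      nlinarith [norm_nonneg (y - p)]
  · have hfr : p ∈ frontier U := hU.frontier_eq ▸ ⟨hp, hpU⟩
    obtain ⟨r, α, γ, hr, hγ, hγ2, hs⟩ := hU.locally_sector p hfr
    refine ⟨r, hr, hs ▸ isPreconnected_sector _ _ _ _, fun c hc0 hc1 y hy => ?_⟩
    rw [hs] at hy
    have h1 := sector_scale hy hc0 hc1
    rw [← hs] at h1
    exact h1.1

/-- Absolute continuity of the integral, since the areas of the balls tend to zero. -/
theorem tendsto_setIntegral_ball_zero {U : Set Plane} (g : L2v U) (p : Plane) (R : ℝ) :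
    Tendsto (fun c => ∫ t in U ∩ ball p (c * R), ‖g t‖ ^ 2) (𝓝[>] (0 : ℝ)) (𝓝 0) := by
  have hint : Integrable (fun t => ‖g t‖ ^ 2) (volume.restrict U) :=
    (Lp.memLp g).norm.integrable_sq
  have h1 : Tendsto (volume.restrict U ∘ fun c : ℝ => ball p (c * R)) (𝓝[>] (0 : ℝ)) (𝓝 0) := by
    have h2 : Tendsto (fun c : ℝ => ENNReal.ofReal (c * R) ^ 2 * ENNReal.ofReal Real.pi)
        (𝓝[>] (0 : ℝ)) (𝓝 0) := by
      have h3 : Tendsto (fun c : ℝ => c * R) (𝓝[>] (0 : ℝ)) (𝓝 0) :=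
        tendsto_nhdsWithin_of_tendsto_nhds (by simpa using (tendsto_id (x := 𝓝 (0:ℝ))).mul_const R)
      have h4 := ENNReal.Tendsto.mul_const (b := ENNReal.ofReal Real.pi)
        (((ENNReal.continuous_pow 2).tendsto _).comp
          ((ENNReal.continuous_ofReal.tendsto 0).comp h3)) (Or.inr ENNReal.ofReal_ne_top)
      simpa using h4
    refine tendsto_of_tendsto_of_tendsto_of_le_of_le tendsto_const_nhds h2
      (fun _ => zero_le) fun c => ?_
    refine (Measure.restrict_apply_le _ _).trans ?_
    rw [EuclideanSpace.volume_ball_fin_two]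
  refine (hint.tendsto_setIntegral_nhds_zero h1).congr fun c => ?_
  rw [Measure.restrict_restrict measurableSet_ball, inter_comm]

/-- An `H¹` function that is constant on each of two disjoint polygons whose closures meet has the
same value on both. -/
theorem IsWeakGrad.eq_of_closure_inter {Ω V V' : Set Plane} (hΩ : IsPolygon Ω) (hV : IsPolygon V)
    (hV' : IsPolygon V') (hVΩ : V ⊆ Ω) (hVΩ' : V' ⊆ Ω)
    {p : Plane} (hp : p ∈ closure V) (hp' : p ∈ closure V') {q : L2 Ω} {g : L2v Ω}
    (h : IsWeakGrad Ω q g) {c c' : ℝ} (hc : ∀ᵐ x ∂volume.restrict V, q x = c)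
    (hc' : ∀ᵐ x ∂volume.restrict V', q x = c') : c = c' := by
  obtain ⟨R, hR, hconn, hcone⟩ := hΩ.exists_cone (closure_mono hVΩ hp)
  -- A small disc inside `W` near p stays inside `W` under contraction to p, because `W` is a cone
  -- there. The mollification at the contracted centre therefore only sees the value d.
  have key : ∀ {W : Set Plane} {d : ℝ}, IsPolygon W → W ⊆ Ω → p ∈ closure W →
      (∀ᵐ x ∂volume.restrict W, q x = d) → ∃ y ∈ Ω ∩ ball p R, ∀ᶠ ε in 𝓝[>] (0 : ℝ),
        ∀ᶠ t in 𝓝[>] (0 : ℝ), mollify (t * ε) (Ω.indicator q) (p + t • (y - p)) = d := by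
    intro W d hW hWΩ hpW hd
    obtain ⟨r, hr, -, hrc⟩ := hW.exists_cone hpW
    obtain ⟨y, hy, hyW⟩ := _root_.mem_closure_iff.1 hpW _ isOpen_ball
      (mem_ball_self (lt_min hr hR) : p ∈ ball p (min r R))
    obtain ⟨δ, hδ, hδW⟩ := Metric.isOpen_iff.1 (hW.isOpen.inter isOpen_ball) y
      ⟨hyW, ball_subset_ball (min_le_left r R) hy⟩
    refine ⟨y, ⟨hWΩ hyW, ball_subset_ball (min_le_right _ _) hy⟩, ?_⟩
    filter_upwards [Ioo_mem_nhdsGT hδ] with ε hε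
    filter_upwards [Ioc_mem_nhdsGT one_pos] with t ht
    have ht0 : 0 < t := ht.1
    refine mollify_eq_of_ae_eq (mul_pos ht0 hε.1) ?_
    have hsub : ball (p + t • (y - p)) (t * ε) ⊆ W := by
      intro z hz
      have hz' : z = p + t • ((p + t⁻¹ • (z - p)) - p) := by
        rw [add_sub_cancel_left, smul_smul, mul_inv_cancel₀ ht0.ne', one_smul, add_sub_cancel]
      rw [hz']
      refine hrc t ht0 ht.2 _ (hδW ?_)
      rw [mem_ball, dist_eq_norm] at hz ⊢
      have h4 : p + t⁻¹ • (z - p) - y = t⁻¹ • (z - (p + t • (y - p))) := by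
        rw [← sub_sub, smul_sub t⁻¹ (z - p), smul_smul, inv_mul_cancel₀ ht0.ne', one_smul]
        abel
      rw [h4, norm_smul, norm_inv, Real.norm_of_nonneg ht0.le, inv_mul_lt_iff₀ ht0]
      exact hz.trans (by gcongr; exact hε.2)
    filter_upwards [ae_restrict_of_ae_restrict_of_subset hsub hd,
      ae_restrict_mem measurableSet_ball] with z hz hzb
    rw [indicator_of_mem (hWΩ (hsub hzb)), hz]
  obtain ⟨y, hy, h1⟩ := key hV hVΩ hp hc
  obtain ⟨y', hy', h2⟩ := key hV' hVΩ' hp' hc'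
  -- The two discs are joined inside the connected cone Ω ∩ `ball p R`. This works even if the two
  -- polygons share only the point p, and if p ∈ ∂Ω.
  have h3 := eventually_tendsto_mollify_sub hΩ.isOpen h (p := p)
    (hΩ.isOpen.inter isOpen_ball) hconn (l := 𝓝[>] (0 : ℝ))
    (by
      filter_upwards [Ioc_mem_nhdsGT one_pos] with t ht
      exact ⟨ht.1, hcone t ht.1 ht.2⟩)
    (fun R _ => tendsto_setIntegral_ball_zero g p R) hy hy'
  obtain ⟨ε, h1, h2, h3⟩ := (h1.and (h2.and h3)).exists
  have h4 : Tendsto (fun _ : ℝ => c - c') (𝓝[>] (0 : ℝ)) (𝓝 0) := by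
    refine h3.congr' ?_
    filter_upwards [h1, h2] with t e1 e2
    rw [e1, e2]
  exact sub_eq_zero.1 (tendsto_nhds_unique tendsto_const_nhds h4)

/-! ### The kernel of `B_h` -/

section Kernel

variable {I J : ℕ} {Ω : Set Plane} {G₁ : Fin I → Set Plane} {G₂ : Fin J → Set Plane}
  {T : Finset (Finset Plane)}

/-- With `divVel_mem_QConst`, this is the compatibility of the discrete spaces that makes [∇q₂,
∇·v₁] an admissible test pair. -/
theorem gradPres_mem_GradQ {Ω₁ Ω₂ : Set Plane} (h₂ : IsOpen Ω₂) (x : Xh Ω Ω₁ Ω₂ T) :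
    gradPres x ∈ GradQ Ω Ω₂ T :=
  ⟨fun t ht hs => IsWeakGrad.isConstOn (isOpen_triangle t) h₂ hs x.1.snd.2 (x.2.2.2 t ht hs),
    x.1.snd, x.2.2, rfl⟩

theorem divVel_mem_QConst {Ω₁ Ω₂ : Set Plane} (h₁ : IsOpen Ω₁) (x : Xh Ω Ω₁ Ω₂ T) :
    divVel x ∈ QConst Ω₁ T := fun t ht hs =>
  IsWeakDiv.isConstOn (isOpen_triangle t) h₁ hs x.1.fst.2 (x.2.1 t ht hs)

theorem toLp_mem_Yh {Ω₁ Ω₂ : Set Plane} {w : L2v Ω₂} {r : L2 Ω₁} (hw : w ∈ GradQ Ω Ω₂ T)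
    (hr : r ∈ QConst Ω₁ T) :
    (WithLp.toLp 2 (w, r) : YSpace Ω₁ Ω₂) ∈ Yh Ω Ω₁ Ω₂ T := ⟨hw, hr⟩

theorem formB_toLp {Ω₁ Ω₂ : Set Plane} (x : Xh Ω Ω₁ Ω₂ T) {w : L2v Ω₂} {r : L2 Ω₁}
    (hY : (WithLp.toLp 2 (w, r) : YSpace Ω₁ Ω₂) ∈ Yh Ω Ω₁ Ω₂ T) :
    formB x ⟨_, hY⟩ =
      (∫ s in Ω₁, divVel x s * r s) + ∫ s in Ω₂, inner ℝ (gradPres x s) (w s) := rfl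

theorem integral_mul_self_eq_norm_sq {U : Set Plane} (f : L2 U) :
    ∫ s in U, f s * f s = ‖f‖ ^ 2 := by
  rw [← real_inner_self_eq_norm_sq, L2.inner_def]
  refine integral_congr_ae (Eventually.of_forall fun s => ?_)
  simp only [real_inner_self_eq_norm_sq, Real.norm_eq_abs, sq_abs]
  ring

theorem integral_inner_self_eq_norm_sq {U : Set Plane} (f : L2v U) :
    ∫ s in U, inner ℝ (f s) (f s) = ‖f‖ ^ 2 := by
  rw [← real_inner_self_eq_norm_sq, L2.inner_def]

/-- Tested with [∇q₂, ∇·v₁], the form B_h is the sum of the two squared norms. -/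
theorem eq_zero_of_mem_kerB {Ω₁ Ω₂ : Set Plane} (h₁ : IsOpen Ω₁) (h₂ : IsOpen Ω₂)
    {x : Xh Ω Ω₁ Ω₂ T} (hx : x ∈ kerB Ω Ω₁ Ω₂ T) : divVel x = 0 ∧ gradPres x = 0 := by
  have h := hx ⟨_, toLp_mem_Yh (gradPres_mem_GradQ h₂ x) (divVel_mem_QConst h₁ x)⟩
  rw [formB_toLp, integral_mul_self_eq_norm_sq, integral_inner_self_eq_norm_sq] at h
  constructor
  · rw [← norm_eq_zero]
    nlinarith [sq_nonneg ‖divVel x‖, sq_nonneg ‖gradPres x‖]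
  · rw [← norm_eq_zero]
    nlinarith [sq_nonneg ‖divVel x‖, sq_nonneg ‖gradPres x‖]

/-- A member of `Q(Ω₂)` with zero gradient is one constant on all of `Ω₂`. -/
theorem GeometricHypothesis.isConstOn_pres (hΩ : GeometricHypothesis Ω G₁ G₂)
    {x : Xh Ω (region G₁) (region G₂) T} (hx : gradPres x = 0) :
    IsConstOn (region G₂) (pres x) := by
  have hsub : ∀ j, G₂ j ⊆ region G₂ := fun j => subset_iUnion G₂ j
  have hloc : ∀ j, ∃ c : ℝ, ∀ᵐ y ∂volume.restrict (G₂ j), pres x y = c := fun j =>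
    IsWeakGrad.exists_ae_eq_const hΩ.isOpen_region₂ x.1.snd.2 (hsub j) (hΩ.polygon₂ j).isOpen
      (hΩ.polygon₂ j).isConnected.isPreconnected hx
  choose c hc using hloc
  -- The extension to Ω links pieces of Ω₂ that touch only at a point, where the weak gradient on Ω₂
  -- itself gives no relation.
  obtain ⟨ξ, hξ⟩ := x.2.2.1
  have hξc : ∀ j, ∀ᵐ y ∂volume.restrict (G₂ j), ξ.1.fst y = c j := by
    intro j
    filter_upwards [hc j, ae_restrict_of_ae_restrict_of_subset
      (subset_inter ((hsub j).trans hΩ.region₂_subset) (hsub j)) hξ] with y h1 h2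
    rw [← h2]
    exact h1
  have hne : (region G₂).Nonempty := closure_nonempty_iff.1 hΩ.connected₂.nonempty
  obtain ⟨j₀, hj₀⟩ := nonempty_iUnion.1 hne
  have hall : ∀ j, c j = c j₀ := by
    by_contra! hex
    obtain ⟨j₁, hj₁⟩ := hex
    have hcl : closure (region G₂) = ⋃ j, closure (G₂ j) := closure_iUnion_of_finite G₂
    -- The pieces are split by whether their constant equals `c j₀`. The two unions of closures are
    -- closed and cover a connected set, so they share a point p, where the touching lemma gives a
    -- contradiction.
    have hmeet := isPreconnected_closed_iff.1 hΩ.connected₂.isPreconnected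
      (⋃ j : {j // c j = c j₀}, closure (G₂ j)) (⋃ j : {j // c j ≠ c j₀}, closure (G₂ j))
      (isClosed_iUnion_of_finite fun _ => isClosed_closure)
      (isClosed_iUnion_of_finite fun _ => isClosed_closure)
      (by
        rw [hcl]
        refine iUnion_subset fun j => ?_
        by_cases hj : c j = c j₀
        · exact (subset_iUnion (fun j : {j // c j = c j₀} => closure (G₂ j)) ⟨j, hj⟩).trans
            subset_union_left
        · exact (subset_iUnion (fun j : {j // c j ≠ c j₀} => closure (G₂ j)) ⟨j, hj⟩).trans
            subset_union_right)
      (by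
        obtain ⟨y, hy⟩ := hj₀
        exact ⟨y, subset_closure (hsub j₀ hy), mem_iUnion.2 ⟨⟨j₀, rfl⟩, subset_closure hy⟩⟩)
      (by
        obtain ⟨y, hy⟩ := (hΩ.polygon₂ j₁).isConnected.nonempty
        exact ⟨y, subset_closure (hsub j₁ hy), mem_iUnion.2 ⟨⟨j₁, hj₁⟩, subset_closure hy⟩⟩)
    obtain ⟨p, -, hp, hp'⟩ := hmeet
    obtain ⟨⟨i, hi⟩, hpi⟩ := mem_iUnion.1 hp
    obtain ⟨⟨k, hk⟩, hpk⟩ := mem_iUnion.1 hp'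
    refine hk ?_
    rw [← hi]
    exact (IsWeakGrad.eq_of_closure_inter hΩ.domain (hΩ.polygon₂ i) (hΩ.polygon₂ k)
      ((hsub i).trans hΩ.region₂_subset) ((hsub k).trans hΩ.region₂_subset) hpi hpk ξ.2
      (hξc i) (hξc k)).symm
  refine ⟨c j₀, ?_⟩
  refine (ae_restrict_iUnion_iff G₂ _).2 fun j => ?_
  filter_upwards [hc j] with y hy
  rw [hy, hall j]

end Kernel

/-! ### The discrete spaces are finite dimensional -/

section Finite

variable {ι F P : Type*} [NormedAddCommGroup F] [NormedSpace ℝ F] [AddCommGroup P] [Module ℝ P]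
  {U : Set Plane} {s : Finset ι} {K : ι → Set Plane}

omit [NormedSpace ℝ F] in
theorem IsTiling.memLp_indicator (h : IsTiling U s K) {i : ι} (hi : i ∈ s) {p : Plane → F}
    (hp : Continuous p) : MemLp ((K i).indicator p) 2 (volume.restrict U) := by
  have : IsFiniteMeasure (volume.restrict U) :=
    ⟨by rw [Measure.restrict_apply_univ]; exact h.volume_lt_top⟩
  have hb : Bornology.IsBounded (K i) := h.isBounded_set.subset (h.subset i hi)
  obtain ⟨C, hC⟩ := hb.isCompact_closure.exists_bound_of_continuousOn hp.continuousOn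
  refine MemLp.of_bound (hp.aestronglyMeasurable.indicator (h.isOpen i hi).measurableSet) |C|
    (Eventually.of_forall fun x => ?_)
  by_cases hx : x ∈ K i
  · rw [indicator_of_mem hx]
    exact (hC x (subset_closure hx)).trans (le_abs_self C)
  · rw [indicator_of_notMem hx, norm_zero]
    exact abs_nonneg C

/-- Functions that belong on each piece to a given finite dimensional space of continuous
functions form a finite dimensional space. -/
theorem IsTiling.exists_finiteDimensional (h : IsTiling U s K) [FiniteDimensional ℝ P]
    (ev : P →ₗ[ℝ] Plane → F) (hev : ∀ c, Continuous (ev c)) :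
    ∃ M : Submodule ℝ (Lp F 2 (volume.restrict U)), FiniteDimensional ℝ M ∧
      ∀ f : Lp F 2 (volume.restrict U),
        (∀ i ∈ s, ∃ c : P, ∀ᵐ x ∂volume.restrict (K i), f x = ev c x) → f ∈ M := by
  have hmem : ∀ c : s → P, MemLp (fun x => ∑ i : s, (K i).indicator (ev (c i)) x) 2
      (volume.restrict U) := fun c =>
    memLp_finsetSum _ fun i _ => h.memLp_indicator i.2 (hev (c i))
  -- Glues a family of coefficients into a function, extended by zero outside each piece; the range
  -- of this map is the required space.
  let Φ : (s → P) →ₗ[ℝ] Lp F 2 (volume.restrict U) :=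
    { toFun := fun c => (hmem c).toLp _
      map_add' := fun c d => by
        rw [← MemLp.toLp_add]
        refine MemLp.toLp_congr _ _ (Eventually.of_forall fun x => ?_)
        simp only [Pi.add_apply, map_add, indicator_add', ← Finset.sum_add_distrib]
      map_smul' := fun t c => by
        rw [RingHom.id_apply, ← MemLp.toLp_const_smul]
        refine MemLp.toLp_congr _ _ (Eventually.of_forall fun x => ?_)
        simp only [Pi.smul_apply, map_smul, Finset.smul_sum]
        refine Finset.sum_congr rfl fun i _ => ?_
        rw [← indicator_const_smul_apply]
        rfl }
  refine ⟨LinearMap.range Φ, inferInstance, fun f hf => ?_⟩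
  choose! c hc using hf
  refine ⟨fun i => c i, Lp.ext ?_⟩
  refine (MemLp.coeFn_toLp (hmem fun i => c i)).trans ?_
  refine h.ae_of_forall fun i hi => ?_
  filter_upwards [hc i hi, ae_restrict_mem (h.isOpen i hi).measurableSet] with x hx hxK
  rw [hx, Finset.sum_eq_single (⟨i, hi⟩ : s), indicator_of_mem hxK]
  · rintro ⟨j, hj⟩ _ hne
    refine indicator_of_notMem (fun hxj => ?_) _
    exact (Set.disjoint_left.1 (h.disjoint hi hj fun h => hne (by simp [h])) hxK) hxj
  · simp

end Finite

section FiniteXh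

variable {Ω Ω₁ Ω₂ : Set Plane} {T : Finset (Finset Plane)}

/-- The polynomials of degree at most one. -/
def affineEval : (ℝ × Plane) →ₗ[ℝ] Plane → ℝ where
  toFun c x := c.1 + inner ℝ c.2 x
  map_add' c d := by
    funext x
    simp only [Prod.fst_add, Prod.snd_add, inner_add_left, Pi.add_apply]
    ring
  map_smul' t c := by
    funext x
    simp only [Prod.smul_fst, Prod.smul_snd, real_inner_smul_left, Pi.smul_apply, smul_eq_mul,
      RingHom.id_apply]
    ring

/-- The Raviart-Thomas polynomials of lowest order. -/
def rtEval : (Plane × ℝ) →ₗ[ℝ] Plane → Plane where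
  toFun c x := c.1 + c.2 • x
  map_add' c d := by
    funext x
    simp only [Prod.fst_add, Prod.snd_add, Pi.add_apply]
    module
  map_smul' t c := by
    funext x
    simp only [Prod.smul_fst, Prod.smul_snd, Pi.smul_apply, smul_eq_mul, RingHom.id_apply]
    module

/-- The constants. -/
def constEval (F : Type*) [AddCommGroup F] [Module ℝ F] : F →ₗ[ℝ] Plane → F where
  toFun c _ := c
  map_add' _ _ := rfl
  map_smul' _ _ := rfl

/-- An element is determined by v₁, ∇·v₁, q₂ and ∇q₂, each a piecewise polynomial of a fixed type on
the tiling. Continuity of every bilinear form on X_h is then automatic. -/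
theorem finiteDimensional_Xh [DecidablePred fun t : Finset Plane => triangle t ⊆ Ω₁]
    [DecidablePred fun t : Finset Plane => triangle t ⊆ Ω₂]
    (h₁ : IsTiling Ω₁ (T.filter fun t => triangle t ⊆ Ω₁) triangle)
    (h₂ : IsTiling Ω₂ (T.filter fun t => triangle t ⊆ Ω₂) triangle) :
    FiniteDimensional ℝ (Xh Ω Ω₁ Ω₂ T) := by
  obtain ⟨Mv, _, hv⟩ := h₁.exists_finiteDimensional rtEval
    (fun c => by simp only [rtEval, LinearMap.coe_mk, AddHom.coe_mk]; fun_prop)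
  obtain ⟨Md, _, hd⟩ := h₁.exists_finiteDimensional (constEval ℝ) (fun c => continuous_const)
  obtain ⟨Mq, _, hq⟩ := h₂.exists_finiteDimensional affineEval
    (fun c => by simp only [affineEval, LinearMap.coe_mk, AddHom.coe_mk]; fun_prop)
  obtain ⟨Mg, _, hg⟩ := h₂.exists_finiteDimensional (constEval Plane) (fun c => continuous_const)
  have mv : ∀ x : Xh Ω Ω₁ Ω₂ T, vel x ∈ Mv := fun x => hv _ fun t ht => by
    obtain ⟨c, r, h⟩ := x.2.1 t (Finset.mem_filter.1 ht).1 (Finset.mem_filter.1 ht).2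
    exact ⟨(c, r), h⟩
  have md : ∀ x : Xh Ω Ω₁ Ω₂ T, divVel x ∈ Md := fun x => hd _ fun t ht => by
    rw [Finset.mem_filter] at ht
    exact IsWeakDiv.isConstOn (isOpen_triangle t) h₁.isOpen_set ht.2 x.1.fst.2
      (x.2.1 t ht.1 ht.2)
  have mq : ∀ x : Xh Ω Ω₁ Ω₂ T, pres x ∈ Mq := fun x => hq _ fun t ht => by
    obtain ⟨c, b, h⟩ := x.2.2.2 t (Finset.mem_filter.1 ht).1 (Finset.mem_filter.1 ht).2
    exact ⟨(c, b), h⟩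
  have mg : ∀ x : Xh Ω Ω₁ Ω₂ T, gradPres x ∈ Mg := fun x => hg _ fun t ht => by
    rw [Finset.mem_filter] at ht
    exact IsWeakGrad.isConstOn (isOpen_triangle t) h₂.isOpen_set ht.2 x.1.snd.2
      (x.2.2.2 t ht.1 ht.2)
  let Φ : Xh Ω Ω₁ Ω₂ T →ₗ[ℝ] (Mv × Md) × (Mq × Mg) :=
    { toFun := fun x => ((⟨vel x, mv x⟩, ⟨divVel x, md x⟩), (⟨pres x, mq x⟩, ⟨gradPres x, mg x⟩))
      map_add' := fun _ _ => rfl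
      map_smul' := fun _ _ => rfl }
  refine FiniteDimensional.of_injective Φ fun x y hxy => ?_
  have e1 : vel x = vel y := congrArg (fun z => (z.1.1 : L2v Ω₁)) hxy
  have e2 : divVel x = divVel y := congrArg (fun z => (z.1.2 : L2 Ω₁)) hxy
  have e3 : pres x = pres y := congrArg (fun z => (z.2.1 : L2 Ω₂)) hxy
  have e4 : gradPres x = gradPres y := congrArg (fun z => (z.2.2 : L2v Ω₂)) hxy
  refine Subtype.ext (WithLp.ofLp_injective 2 (Prod.ext ?_ ?_))
  · exact Subtype.ext (WithLp.ofLp_injective 2 (Prod.ext e1 e2))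
  · exact Subtype.ext (WithLp.ofLp_injective 2 (Prod.ext e3 e4))

end FiniteXh

/-! ### Bilinear forms given by integrals -/

/-- Linearity of the integrand is asked only almost everywhere, since representatives of L² classes
add only up to null sets. -/
theorem exists_bilin_integral {X Y α : Type*} [AddCommGroup X] [Module ℝ X] [AddCommGroup Y]
    [Module ℝ Y] [MeasurableSpace α] {μ : Measure α} (k : X → Y → α → ℝ)
    (hint : ∀ x y, Integrable (k x y) μ)
    (add_left : ∀ x x' y, k (x + x') y =ᵐ[μ] k x y + k x' y)
    (smul_left : ∀ (c : ℝ) x y, k (c • x) y =ᵐ[μ] c • k x y)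
    (add_right : ∀ x y y', k x (y + y') =ᵐ[μ] k x y + k x y')
    (smul_right : ∀ (c : ℝ) x y, k x (c • y) =ᵐ[μ] c • k x y) :
    ∃ B : X →ₗ[ℝ] Y →ₗ[ℝ] ℝ, ∀ x y, B x y = ∫ t, k x y t ∂μ := by
  refine ⟨LinearMap.mk₂ ℝ (fun x y => ∫ t, k x y t ∂μ) (fun x x' y => ?_) (fun c x y => ?_)
    (fun x y y' => ?_) (fun c x y => ?_), fun x y => rfl⟩
  · rw [integral_congr_ae (add_left x x' y)]
    exact integral_add (hint x y) (hint x' y)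
  · rw [integral_congr_ae (smul_left c x y)]
    exact integral_smul c _
  · rw [integral_congr_ae (add_right x y y')]
    exact integral_add (hint x y) (hint x y')
  · rw [integral_congr_ae (smul_right c x y)]
    exact integral_smul c _

/-- On a finite dimensional space, each combination of bilinear forms is given by a continuous
operator into the dual space. -/
theorem exists_clm_eq_bilin {E : Type*} [NormedAddCommGroup E] [NormedSpace ℝ E]
    (S : Submodule ℝ E) [FiniteDimensional ℝ S] (B₁ B₂ B₃ : S →ₗ[ℝ] S →ₗ[ℝ] ℝ) :
    ∃ A : S →L[ℝ] (S →L[ℝ] ℝ), ∀ x y, A x y = B₁ x y + B₂ x y - B₃ x y + B₃ y x :=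
  ⟨LinearMap.toContinuousLinearMap
    ((LinearMap.toContinuousLinearMap : (S →ₗ[ℝ] ℝ) ≃ₗ[ℝ] _).toLinearMap ∘ₗ
      (B₁ + B₂ - B₃ + B₃.flip)), fun _ _ => rfl⟩

section Forms

variable {Ω Ω₁ Ω₂ : Set Plane} {T : Finset (Finset Plane)} {ι : Type*}

theorem vel_add (x y : Xh Ω Ω₁ Ω₂ T) : vel (x + y) = vel x + vel y := rfl

theorem vel_smul (c : ℝ) (x : Xh Ω Ω₁ Ω₂ T) : vel (c • x) = c • vel x := rfl

/-- The volume term of `A_h`. -/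
theorem exists_bilin_volume {a : Plane → ℝ} (ha : MemLp a ∞ (volume.restrict Ω₁)) :
    ∃ B : Xh Ω Ω₁ Ω₂ T →ₗ[ℝ] Xh Ω Ω₁ Ω₂ T →ₗ[ℝ] ℝ,
      ∀ x y, B x y = ∫ s in Ω₁, a s * inner ℝ (vel x s) (vel y s) := by
  refine exists_bilin_integral _ (fun x y => ?_) (fun x x' y => ?_) (fun c x y => ?_)
    (fun x y y' => ?_) (fun c x y => ?_)
  · have h1 : MemLp (fun s => (inner ℝ (vel x s) (vel y s) : ℝ)) 1 (volume.restrict Ω₁) :=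
      memLp_one_iff_integrable.2 (L2.integrable_inner (𝕜 := ℝ) (vel x) (vel y))
    exact memLp_one_iff_integrable.1 (h1.mul ha)
  · filter_upwards [Lp.coeFn_add (vel x) (vel x')] with s hs
    simp only [vel_add, Pi.add_apply, hs, inner_add_left]
    ring
  · filter_upwards [Lp.coeFn_smul c (vel x)] with s hs
    simp only [vel_smul, Pi.smul_apply, hs, real_inner_smul_left, smul_eq_mul]
    ring
  · filter_upwards [Lp.coeFn_add (vel y) (vel y')] with s hs
    simp only [vel_add, Pi.add_apply, hs, inner_add_right]
    ring
  · filter_upwards [Lp.coeFn_smul c (vel y)] with s hs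
    simp only [vel_smul, Pi.smul_apply, hs, real_inner_smul_right, smul_eq_mul]
    ring

/-! ### Traces of discrete functions and the interface terms -/

section Traces

variable [DecidablePred fun t : Finset Plane => triangle t ⊆ Ω₁]
  [DecidablePred fun t : Finset Plane => triangle t ⊆ Ω₂]

omit [DecidablePred fun t : Finset Plane => triangle t ⊆ Ω₂] in
theorem isPiecewiseContinuous_vel (x : Xh Ω Ω₁ Ω₂ T) :
    IsPiecewiseContinuous (T.filter fun t => triangle t ⊆ Ω₁) triangle (vel x) := by
  intro t ht
  obtain ⟨c, r, h⟩ := x.2.1 t (Finset.mem_filter.1 ht).1 (Finset.mem_filter.1 ht).2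
  exact ⟨fun x => c + r • x, by fun_prop, h⟩

omit [DecidablePred fun t : Finset Plane => triangle t ⊆ Ω₁] in
theorem isPiecewiseContinuous_pres (x : Xh Ω Ω₁ Ω₂ T) :
    IsPiecewiseContinuous (T.filter fun t => triangle t ⊆ Ω₂) triangle (pres x) := by
  intro t ht
  obtain ⟨c, b, h⟩ := x.2.2.2 t (Finset.mem_filter.1 ht).1 (Finset.mem_filter.1 ht).2
  exact ⟨fun x => c + inner ℝ b x, by fun_prop, h⟩

theorem IsTiling.integrableOn_Lp {F : Type*} [NormedAddCommGroup F] {U : Set Plane} {s : Finset ι}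
    {K : ι → Set Plane} (h : IsTiling U s K) (f : Lp F 2 (volume.restrict U)) :
    IntegrableOn f U := by
  have : IsFiniteMeasure (volume.restrict U) :=
    ⟨by rw [Measure.restrict_apply_univ]; exact h.volume_lt_top⟩
  exact (Lp.memLp f).integrable (by norm_num)

theorem IsTiling.memLp_top_trace {F : Type*} [NormedAddCommGroup F] [NormedSpace ℝ F]
    [CompleteSpace F] {U : Set Plane} {s : Finset ι} {K : ι → Set Plane} (h : IsTiling U s K)
    {f : Lp F 2 (volume.restrict U)} (hf : IsPiecewiseContinuous s K f) (μ : Measure Plane) :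
    MemLp (trace U f) ∞ μ := by
  obtain ⟨C, hC0, hC⟩ := h.exists_bound hf
  exact memLp_top_of_bound (h.stronglyMeasurable_trace hf (h.integrableOn_Lp f)
    (Lp.stronglyMeasurable f)).aestronglyMeasurable C
    (Eventually.of_forall (h.norm_trace_le hf (h.integrableOn_Lp f) hC0 hC))

variable (h₁ : IsTiling Ω₁ (T.filter fun t => triangle t ⊆ Ω₁) triangle)
  (h₂ : IsTiling Ω₂ (T.filter fun t => triangle t ⊆ Ω₂) triangle)
include h₂

omit [DecidablePred fun t : Finset Plane => triangle t ⊆ Ω₁] in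
theorem trace_pres_add (x y : Xh Ω Ω₁ Ω₂ T) :
    trace Ω₂ (pres (x + y)) = trace Ω₂ (pres x) + trace Ω₂ (pres y) :=
  h₂.trace_add (isPiecewiseContinuous_pres x) (isPiecewiseContinuous_pres y)
    (h₂.integrableOn_Lp _) (h₂.integrableOn_Lp _) (Lp.coeFn_add (pres x) (pres y))

omit [DecidablePred fun t : Finset Plane => triangle t ⊆ Ω₁] in
theorem trace_pres_smul (c : ℝ) (x : Xh Ω Ω₁ Ω₂ T) :
    trace Ω₂ (pres (c • x)) = c • trace Ω₂ (pres x) :=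
  h₂.trace_smul c (isPiecewiseContinuous_pres x) (h₂.integrableOn_Lp _)
    (Lp.coeFn_smul c (pres x))

omit [DecidablePred fun t : Finset Plane => triangle t ⊆ Ω₁] in
/-- The boundary term of `A_h` that contains `β`. -/
theorem exists_bilin_boundary {β : Plane → ℝ} {μ : Measure Plane} [IsFiniteMeasure μ]
    (hβ : MemLp β ∞ μ) :
    ∃ B : Xh Ω Ω₁ Ω₂ T →ₗ[ℝ] Xh Ω Ω₁ Ω₂ T →ₗ[ℝ] ℝ,
      ∀ x y, B x y = ∫ s, β s * trace Ω₂ (pres x) s * trace Ω₂ (pres y) s ∂μ := by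
  have hm : ∀ x : Xh Ω Ω₁ Ω₂ T, MemLp (trace Ω₂ (pres x)) ∞ μ := fun x =>
    h₂.memLp_top_trace (isPiecewiseContinuous_pres x) μ
  refine exists_bilin_integral _ (fun x y => ?_) (fun x x' y => .of_eq (funext fun s => ?_))
    (fun c x y => .of_eq (funext fun s => ?_)) (fun x y y' => .of_eq (funext fun s => ?_))
    (fun c x y => .of_eq (funext fun s => ?_))
  · have h := (hm y).mul (r := ∞) ((hm x).mul (r := ∞) hβ)
    exact h.integrable le_top
  all_goals
    simp only [trace_pres_add h₂, trace_pres_smul h₂, Pi.add_apply, Pi.smul_apply, smul_eq_mul]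
    ring

include h₁

/-- The coupling term of `A_h`. -/
theorem exists_bilin_coupling (μ : Measure Plane) [IsFiniteMeasure μ] :
    ∃ B : Xh Ω Ω₁ Ω₂ T →ₗ[ℝ] Xh Ω Ω₁ Ω₂ T →ₗ[ℝ] ℝ, ∀ x y, B x y =
      ∫ s, inner ℝ (trace Ω₁ (vel x) s) (outerNormal Ω₁ s) * trace Ω₂ (pres y) s ∂μ := by
  have hv_add : ∀ x y : Xh Ω Ω₁ Ω₂ T,
      trace Ω₁ (vel (x + y)) = trace Ω₁ (vel x) + trace Ω₁ (vel y) := fun x y =>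
    h₁.trace_add (isPiecewiseContinuous_vel x) (isPiecewiseContinuous_vel y)
      (h₁.integrableOn_Lp _) (h₁.integrableOn_Lp _) (Lp.coeFn_add (vel x) (vel y))
  have hv_smul : ∀ (c : ℝ) (x : Xh Ω Ω₁ Ω₂ T),
      trace Ω₁ (vel (c • x)) = c • trace Ω₁ (vel x) := fun c x =>
    h₁.trace_smul c (isPiecewiseContinuous_vel x) (h₁.integrableOn_Lp _)
      (Lp.coeFn_smul c (vel x))
  refine exists_bilin_integral _ (fun x y => ?_) (fun x x' y => .of_eq (funext fun s => ?_))
    (fun c x y => .of_eq (funext fun s => ?_)) (fun x y y' => .of_eq (funext fun s => ?_))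
    (fun c x y => .of_eq (funext fun s => ?_))
  · have hp := h₂.memLp_top_trace (isPiecewiseContinuous_pres y) μ
    have hv := h₁.memLp_top_trace (isPiecewiseContinuous_vel x) μ
    have hn : AEStronglyMeasurable (outerNormal Ω₁) μ :=
      (measurable_outerNormal h₁.isOpen_set).aestronglyMeasurable
    have hvn : MemLp (fun s => (inner ℝ (trace Ω₁ (vel x) s) (outerNormal Ω₁ s) : ℝ)) ∞ μ := by
      refine hv.norm.mono (hv.1.inner (𝕜 := ℝ) hn) (Eventually.of_forall fun s => ?_)
      rw [norm_norm]
      refine (norm_inner_le_norm _ _).trans ?_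
      exact mul_le_of_le_one_right (norm_nonneg _) (norm_outerNormal_le _ _)
    exact (hp.mul (r := ∞) hvn).integrable le_top
  all_goals
    simp only [trace_pres_add h₂, trace_pres_smul h₂, hv_add, hv_smul, Pi.add_apply, Pi.smul_apply,
      smul_eq_mul, inner_add_left, real_inner_smul_left]
    ring

/-- The last term of A_h is the coupling form with its arguments exchanged, so three bilinear forms
suffice. -/
theorem exists_bilin_formA {a β : Plane → ℝ} {Γ : Set Plane}
    (ha : MemLp a ∞ (volume.restrict Ω₁)) (hβ : MemLp β ∞ (surfaceMeasure Γ))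
    [IsFiniteMeasure (surfaceMeasure Γ)] :
    ∃ B₁ B₂ B₃ : Xh Ω Ω₁ Ω₂ T →ₗ[ℝ] Xh Ω Ω₁ Ω₂ T →ₗ[ℝ] ℝ,
      ∀ x y, B₁ x y + B₂ x y - B₃ x y + B₃ y x = formA a β Γ x y := by
  refine (exists_bilin_volume (Ω := Ω) (Ω₂ := Ω₂) (T := T) ha).elim fun B₁ hB₁ =>
    (exists_bilin_boundary (Ω := Ω) (Ω₁ := Ω₁) h₂ hβ).elim fun B₂ hB₂ =>
    (exists_bilin_coupling (Ω := Ω) h₁ h₂ (surfaceMeasure Γ)).elim fun B₃ hB₃ =>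
    ⟨B₁, B₂, B₃, fun x y => ?_⟩
  have h₃ : B₃ y x = ∫ s, trace Ω₂ (pres x) s *
      inner ℝ (trace Ω₁ (vel y) s) (outerNormal Ω₁ s) ∂surfaceMeasure Γ :=
    (hB₃ y x).trans (integral_congr_ae (Eventually.of_forall fun s => mul_comm _ _))
  exact congrArg₂ (· + ·) (congrArg₂ (· - ·) (congrArg₂ (· + ·) (hB₁ x y) (hB₂ x y)) (hB₃ x y)) h₃

omit h₁ h₂ [DecidablePred fun t : Finset Plane => triangle t ⊆ Ω₁]
  [DecidablePred fun t : Finset Plane => triangle t ⊆ Ω₂] in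
theorem exists_clm_Xh [FiniteDimensional ℝ (Xh Ω Ω₁ Ω₂ T)]
    (B₁ B₂ B₃ : Xh Ω Ω₁ Ω₂ T →ₗ[ℝ] Xh Ω Ω₁ Ω₂ T →ₗ[ℝ] ℝ) :
    ∃ A : Xh Ω Ω₁ Ω₂ T →L[ℝ] (Xh Ω Ω₁ Ω₂ T →L[ℝ] ℝ),
      ∀ x y, A x y = B₁ x y + B₂ x y - B₃ x y + B₃ y x :=
  exists_clm_eq_bilin (Xh Ω Ω₁ Ω₂ T) B₁ B₂ B₃

/-- `A_h` is a continuous linear operator from `X_h` to its dual. -/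
theorem exists_operator_formA {a β : Plane → ℝ} {Γ : Set Plane}
    (ha : MemLp a ∞ (volume.restrict Ω₁)) (hβ : MemLp β ∞ (surfaceMeasure Γ))
    [IsFiniteMeasure (surfaceMeasure Γ)] :
    ∃ A : Xh Ω Ω₁ Ω₂ T →L[ℝ] (Xh Ω Ω₁ Ω₂ T →L[ℝ] ℝ), ∀ x y, A x y = formA a β Γ x y := by
  have := finiteDimensional_Xh (Ω := Ω) h₁ h₂
  exact (exists_bilin_formA (Ω := Ω) h₁ h₂ ha hβ).elim fun B₁ h => h.elim fun B₂ h => h.elim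
    fun B₃ hB => (exists_clm_Xh B₁ B₂ B₃).imp fun A hA x y => (hA x y).trans (hB x y)

end Traces

/-! ### Coercivity -/

theorem norm_sq_Xh (x : Xh Ω Ω₁ Ω₂ T) :
    ‖x‖ ^ 2 = ‖vel x‖ ^ 2 + ‖divVel x‖ ^ 2 + (‖pres x‖ ^ 2 + ‖gradPres x‖ ^ 2) := by
  have h1 : ‖x‖ ^ 2 = ‖x.1.fst‖ ^ 2 + ‖x.1.snd‖ ^ 2 := WithLp.prod_norm_sq_eq_of_L2 x.1
  have h2 : ‖x.1.fst‖ ^ 2 = ‖vel x‖ ^ 2 + ‖divVel x‖ ^ 2 :=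
    WithLp.prod_norm_sq_eq_of_L2 x.1.fst.1
  have h3 : ‖x.1.snd‖ ^ 2 = ‖pres x‖ ^ 2 + ‖gradPres x‖ ^ 2 :=
    WithLp.prod_norm_sq_eq_of_L2 x.1.snd.1
  rw [h1, h2, h3]

/-- The coupling part of A_h is skew-symmetric and vanishes on the diagonal. -/
theorem formA_self (a β : Plane → ℝ) (Γ : Set Plane) (x : Xh Ω Ω₁ Ω₂ T) :
    formA a β Γ x x = (∫ s in Ω₁, a s * inner ℝ (vel x s) (vel x s)) +
      ∫ s, β s * trace Ω₂ (pres x) s * trace Ω₂ (pres x) s ∂(surfaceMeasure Γ) := by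
  rw [formA]
  simp only [mul_comm (trace Ω₂ (pres x) _) (inner ℝ _ _)]
  ring

/-- Almost everywhere 1/a ≤ ‖1/a‖_∞, and a > 0, so a ≥ ‖1/a‖_∞⁻¹. -/
theorem inv_norm_mul_le_integral {U V : Set Plane} (hU : MeasurableSet U) (hUV : U ⊆ V)
    {a : Plane → ℝ} (hpos : ∀ x ∈ U, 0 < a x) (ha : MemLp a ∞ (volume.restrict V))
    (hinv : MemLp (fun x => 1 / a x) ∞ (volume.restrict V)) (v : L2v U) :
    ((eLpNorm (fun x => 1 / a x) ∞ (volume.restrict V)).toReal)⁻¹ * ‖v‖ ^ 2 ≤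
      ∫ s in U, a s * inner ℝ (v s) (v s) := by
  set M := (eLpNorm (fun x => 1 / a x) ∞ (volume.restrict V)).toReal with hM
  have hle : ∀ᵐ x ∂volume.restrict U, 1 / a x ≤ M := by
    refine ae_restrict_of_ae_restrict_of_subset hUV ?_
    filter_upwards [ae_le_eLpNormEssSup (f := fun x => 1 / a x) (μ := volume.restrict V)]
      with x hx
    rw [← eLpNorm_exponent_top] at hx
    have h1 := ENNReal.toReal_mono hinv.2.ne hx
    rw [toReal_enorm] at h1
    exact (le_abs_self _).trans h1
  have ha' : MemLp a ∞ (volume.restrict U) := ha.mono_measure (Measure.restrict_mono hUV le_rfl)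
  have hi : Integrable (fun s => (inner ℝ (v s) (v s) : ℝ)) (volume.restrict U) :=
    L2.integrable_inner (𝕜 := ℝ) v v
  rw [← integral_inner_self_eq_norm_sq, ← integral_const_mul]
  refine integral_mono_ae (hi.const_mul _)
    (memLp_one_iff_integrable.1 ((memLp_one_iff_integrable.2 hi).mul ha')) ?_
  filter_upwards [hle, ae_restrict_mem hU] with x hx hxU
  refine mul_le_mul_of_nonneg_right ?_ real_inner_self_nonneg
  have h0 := hpos x hxU
  refine inv_le_of_inv_le₀ h0 ?_
  rwa [one_div] at hx

theorem toReal_eLpNorm_one_eq_integral {α : Type*} [MeasurableSpace α] {μ : Measure α} {f : α → ℝ}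
    (hf : AEStronglyMeasurable f μ) (h0 : 0 ≤ᵐ[μ] f) : (eLpNorm f 1 μ).toReal = ∫ x, f x ∂μ := by
  rw [eLpNorm_one_eq_lintegral_enorm, ← integral_norm_eq_lintegral_enorm hf]
  refine integral_congr_ae ?_
  filter_upwards [h0] with x hx
  exact Real.norm_of_nonneg hx

theorem norm_sq_of_ae_eq_const {U : Set Plane} {f : L2 U} {c : ℝ}
    (h : ∀ᵐ x ∂volume.restrict U, f x = c) : ‖f‖ ^ 2 = (volume U).toReal * c ^ 2 := by
  have h1 : ∫ s in U, f s * f s = ∫ _s in U, c ^ 2 := by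
    refine integral_congr_ae ?_
    filter_upwards [h] with x hx
    rw [hx, sq]
  rw [← integral_mul_self_eq_norm_sq, h1, setIntegral_const, smul_eq_mul, measureReal_def]

end Forms

/-! ### The constant and the coercivity estimate -/

section Main

variable {I J : ℕ} {Ω : Set Plane} {G₁ : Fin I → Set Plane} {G₂ : Fin J → Set Plane}
  {a β : Plane → ℝ} {T : Finset (Finset Plane)}

theorem GeometricHypothesis.volume_region₂_pos (hΩ : GeometricHypothesis Ω G₁ G₂) :
    0 < (volume (region G₂)).toReal := by
  have hne : (region G₂).Nonempty := closure_nonempty_iff.1 hΩ.connected₂.nonempty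
  exact ENNReal.toReal_pos (hΩ.isOpen_region₂.measure_pos _ hne).ne'
    (hΩ.domain.isBounded.subset hΩ.region₂_subset).measure_lt_top.ne

theorem coercivityConst_pos (hΩ : GeometricHypothesis Ω G₁ G₂)
    (hcoef : CoefficientHypothesis Ω (interface Ω G₁ G₂) a β) :
    0 < coercivityConst Ω (region G₂) (interface Ω G₁ G₂) a β := by
  have := hΩ.isFiniteMeasure_surfaceMeasure
  refine lt_min (inv_pos.2 (ENNReal.toReal_pos ?_ hcoef.inv_a_bounded.2.ne))
    (div_pos (ENNReal.toReal_pos hcoef.β_pos.ne' ?_) hΩ.volume_region₂_pos)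
  -- The norm of 1/a is nonzero because 1/a > 0 on Ω, which has positive area; otherwise the inverse
  -- would be 0 by convention.
  · rw [Ne, eLpNorm_eq_zero_iff hcoef.inv_a_bounded.1 ENNReal.top_ne_zero]
    intro h
    have hne : (ae (volume.restrict Ω)).NeBot := by
      rw [ae_neBot, Ne, Measure.restrict_eq_zero]
      exact (hΩ.domain.isOpen.measure_pos _ hΩ.domain.isConnected.nonempty).ne'
    obtain ⟨x, hx, hxΩ⟩ := (h.and (ae_restrict_mem hΩ.domain.isOpen.measurableSet)).exists
    exact (one_div_pos.2 (hcoef.a_pos x hxΩ)).ne' hx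
  · exact (hcoef.β_bounded.mono_exponent le_top).2.ne

theorem coercivityConst_mul_le (hΩ : GeometricHypothesis Ω G₁ G₂)
    (hcoef : CoefficientHypothesis Ω (interface Ω G₁ G₂) a β)
    {x : Xh Ω (region G₁) (region G₂) T} (hx : x ∈ kerB Ω (region G₁) (region G₂) T) :
    coercivityConst Ω (region G₂) (interface Ω G₁ G₂) a β * ‖x‖ ^ 2 ≤
      formA a β (interface Ω G₁ G₂) x x := by
  obtain ⟨hdiv, hgrad⟩ := eq_zero_of_mem_kerB hΩ.isOpen_region₁ hΩ.isOpen_region₂ hx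
  obtain ⟨c, hc⟩ := hΩ.isConstOn_pres hgrad
  have hfin := hΩ.isFiniteMeasure_surfaceMeasure
  have hv := inv_norm_mul_le_integral hΩ.isOpen_region₁.measurableSet hΩ.region₁_subset
    (fun y hy => hcoef.a_pos y (hΩ.region₁_subset hy)) hcoef.a_bounded hcoef.inv_a_bounded (vel x)
  have hΓ : ∀ᵐ s ∂surfaceMeasure (interface Ω G₁ G₂), s ∈ interface Ω G₁ G₂ :=
    ae_restrict_mem GeometricHypothesis.measurableSet_interface
  have hb : ∫ s, β s * trace (region G₂) (pres x) s * trace (region G₂) (pres x) s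
      ∂surfaceMeasure (interface Ω G₁ G₂) =
      (eLpNorm β 1 (surfaceMeasure (interface Ω G₁ G₂))).toReal * c ^ 2 := by
    rw [toReal_eLpNorm_one_eq_integral hcoef.β_bounded.1
      (hΓ.mono fun s hs => hcoef.β_nonneg s hs), ← integral_mul_const]
    refine integral_congr_ae ?_
    filter_upwards [hΓ] with s hs
    -- The constant is the same along all of Γ, so the whole mass of β is available, wherever β is
    -- concentrated.
    rw [trace_eq_const hΩ.isOpen_region₂ (hΩ.interface_subset hs) hc]
    ring
  -- On the kernel the squared norm is ‖v₁‖² + |Ω₂|c². The two entries of the minimum bound the two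
  -- summands separately.
  rw [formA_self, hb, norm_sq_Xh, hdiv, hgrad, norm_sq_of_ae_eq_const hc, norm_zero, norm_zero]
  have hV := hΩ.volume_region₂_pos
  have h1 : coercivityConst Ω (region G₂) (interface Ω G₁ G₂) a β * ‖vel x‖ ^ 2 ≤
      ((eLpNorm (fun x => 1 / a x) ∞ (volume.restrict Ω)).toReal)⁻¹ * ‖vel x‖ ^ 2 :=
    mul_le_mul_of_nonneg_right (min_le_left _ _) (sq_nonneg _)
  have h2 : coercivityConst Ω (region G₂) (interface Ω G₁ G₂) a β *
      ((volume (region G₂)).toReal * c ^ 2) ≤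
      (eLpNorm β 1 (surfaceMeasure (interface Ω G₁ G₂))).toReal * c ^ 2 := by
    rw [← mul_assoc]
    refine mul_le_mul_of_nonneg_right ?_ (sq_nonneg _)
    rw [← le_div_iff₀ hV]
    exact min_le_right _ _
  calc _ = coercivityConst Ω (region G₂) (interface Ω G₁ G₂) a β * ‖vel x‖ ^ 2 +
        coercivityConst Ω (region G₂) (interface Ω G₁ G₂) a β *
          ((volume (region G₂)).toReal * c ^ 2) := by ring
    _ ≤ _ := add_le_add (h1.trans hv) h2

end Main

end PrimalDual

end

/-! ### The main theorem -/

open PrimalDual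
theorem mainTheorem8 {I J : ℕ} (Ω : Set Plane)
    (G₁ : Fin I → Set Plane) (G₂ : Fin J → Set Plane)
    (hΩ : GeometricHypothesis Ω G₁ G₂)
    (a β : Plane → ℝ)
    (hcoef : CoefficientHypothesis Ω (interface Ω G₁ G₂) a β)
    (T : Finset (Finset Plane))
    (hT : IsTriangulation Ω T)
    (hcons : IsConsistent T (region G₁) (region G₂)) :
    0 < coercivityConst Ω (region G₂) (interface Ω G₁ G₂) a β ∧
    (∀ x ∈ kerB Ω (region G₁) (region G₂) T,
      divVel x = 0 ∧ IsConstOn (region G₂) (pres x)) ∧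
    ∃ A : Xh Ω (region G₁) (region G₂) T →L[ℝ]
        (Xh Ω (region G₁) (region G₂) T →L[ℝ] ℝ),
      (∀ x y, A x y = formA a β (interface Ω G₁ G₂) x y) ∧
      ∀ x ∈ kerB Ω (region G₁) (region G₂) T,
        coercivityConst Ω (region G₂) (interface Ω G₁ G₂) a β *
          ‖x‖ ^ 2 ≤ A x x := by
  classical
  -- Every triangle lies in one region, so the triangles tile both regions up to null sets.
  have hsub := fun t (ht : t ∈ T) => hΩ.triangle_subset_or hT hcons ht
  have h₁ := hT.isTiling hΩ.isOpen_region₁ (hΩ.domain.isBounded.subset hΩ.region₁_subset)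
    hΩ.region₁_subset hΩ.region₁_inter_region₂ hsub
  have h₂ := hT.isTiling hΩ.isOpen_region₂ (hΩ.domain.isBounded.subset hΩ.region₂_subset)
    hΩ.region₂_subset ((Set.inter_comm _ _).trans hΩ.region₁_inter_region₂)
    (fun t ht => (hsub t ht).symm)
  have hfin := hΩ.isFiniteMeasure_surfaceMeasure
  refine ⟨coercivityConst_pos hΩ hcoef, fun x hx => ?_, ?_⟩
  · obtain ⟨hd, hg⟩ := eq_zero_of_mem_kerB hΩ.isOpen_region₁ hΩ.isOpen_region₂ hx
    exact ⟨hd, hΩ.isConstOn_pres hg⟩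
  · exact (exists_operator_formA (Ω := Ω) h₁ h₂ (hcoef.a_bounded.mono_measure
      (MeasureTheory.Measure.restrict_mono hΩ.region₁_subset le_rfl)) hcoef.β_bounded).imp
        fun A hA => ⟨hA, fun x hx =>
          (coercivityConst_mul_le hΩ hcoef hx).trans (hA x x).ge⟩
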